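/- Let $\Omega=\{(a,b)\in\mathbb R^2 : a,b\in(0,1],\ a+b>1\}$, let $k(a,b)=\left[\frac{1+a}{b}\right]$, and let $T:\Omega\to\Omega$, $T(a,b)=(b,\,-a+k(a,b)\,b)$, be the BCZ map, which is a bijection of $\Omega$. Put $\hat k=\frac12\left(k+k\circ T^{-1}\right)$ and, for $(a,b)\in\Omega$ and $n\ge 1$, $$\hat f_n=\sum_{i=1}^{n}\left(\hat k\bigl(T^{i-1}(a,b)\bigr)-3\right),\qquad \hat f_{-n}=\sum_{i=0}^{n}\left(\hat k\bigl(T^{-i-1}(a,b)\bigr)-3\right).$$ For an irrational number $s$ let $e(s)$, $e^+(s)$, $e^-(s)\in[2,+\infty]$ be the suprema of those $v\in\mathbb R$ for which, respectively, $|s-\frac pq|<\frac1{q^v}$, $\ 0<\frac pq-s<\frac1{q^v}$, $\ 0<s-\frac pq<\frac1{q^v}$ holds for infinitely many rational numbers $\frac pq$ (in lowest terms, $q>0$). The quotients $\frac{e-1}{e}$ and $\frac{e-2}{e}$ are read as $1$ when $e=+\infty$. (1) For every $(a,b)\in\Omega$ with $\frac ba$ irrational, with $e^\pm=e^\pm(\frac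 ba)$, $$\limsup_{n\to+\infty}\frac{\log|\hat f_n|}{\log n}=\max\left\{\frac{e^--1}{e^-},\frac{e^+-2}{e^+}\right\}.$$ (2) For every $(a,b)\in\Omega$ with $\frac ba$ irrational, with $e^\pm=e^\pm(\frac ba)$, $$\limsup_{n\to+\infty}\frac{\log|\hat f_{-n}|}{\log n}=\max\left\{\frac{e^+-1}{e^+},\frac{e^--2}{e^-}\right\}.$$ (3) For Lebesgue-almost every $(a,b)\in\Omega$ with $\frac ba$ irrational, $e(\frac ba)=e^+(\frac ba)=e^-(\frac ba)=2$ and $$\limsup_{n\to+\infty}\frac{\log|\hat f_n|}{\log n}=\limsup_{n\to+\infty}\frac{\log|\hat f_{-n}|}{\log n}=\frac12.$$ -/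

import Mathlib

open Filter MeasureTheory

namespace BCZ

/-- The Farey triangle `Ω = {(a, b) : a, b ∈ (0, 1], a + b > 1}`. -/
def Farey : Set (ℝ × ℝ) :=
  {x | (0 < x.1 ∧ x.1 ≤ 1) ∧ (0 < x.2 ∧ x.2 ≤ 1) ∧ 1 < x.1 + x.2}

/-- The itinerary (index) function `k(a, b) = [(1 + a) / b]`. -/
noncomputable def index (x : ℝ × ℝ) : ℤ := ⌊(1 + x.1) / x.2⌋

/-- The formula of the BCZ map, `(a, b) ↦ (b, -a + [(1 + a) / b] b)`. -/
noncomputable def mapFun (x : ℝ × ℝ) : ℝ × ℝ := (x.2, -x.1 + (index x : ℝ) * x.2)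

theorem swap_mem {x : ℝ × ℝ} (hx : x ∈ Farey) : x.swap ∈ Farey := by
  obtain ⟨h1, h2, h3⟩ := hx
  exact ⟨h2, h1, by simpa [add_comm] using h3⟩

theorem mapFun_mem {x : ℝ × ℝ} (hx : x ∈ Farey) : mapFun x ∈ Farey := by
  obtain ⟨a, b⟩ := x
  obtain ⟨⟨ha, ha1⟩, ⟨hb, hb1⟩, hab⟩ := hx
  simp only at ha ha1 hb hb1 hab
  have h1 : (index (a, b) : ℝ) * b ≤ 1 + a :=
    (le_div_iff₀ hb).1 (Int.floor_le ((1 + a) / b))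
  have h2 : 1 + a < ((index (a, b) : ℝ) + 1) * b :=
    (div_lt_iff₀ hb).1 (Int.lt_floor_add_one ((1 + a) / b))
  refine ⟨⟨hb, hb1⟩, ⟨?_, ?_⟩, ?_⟩ <;> simp only [mapFun] <;> linarith

/-- The inverse of the BCZ map is its conjugate by the swap `(a, b) ↦ (b, a)`. -/
theorem swap_mapFun_swap_mapFun {x : ℝ × ℝ} (hx : x ∈ Farey) :
    (mapFun (mapFun x).swap).swap = x := by
  have hm := mapFun_mem hx
  obtain ⟨a, b⟩ := x
  obtain ⟨⟨ha, ha1⟩, ⟨hb, hb1⟩, hab⟩ := hx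
  simp only at ha ha1 hb hb1 hab
  have hk : index (mapFun (a, b)).swap = index (a, b) := by
    refine Int.floor_eq_iff.2 ⟨?_, ?_⟩
    · simp only [mapFun, Prod.swap]
      rw [le_div_iff₀ hb]
      linarith
    · simp only [mapFun, Prod.swap]
      rw [div_lt_iff₀ hb]
      linarith
  have h : mapFun (mapFun (a, b)).swap = (b, a) := by
    have e : mapFun (mapFun (a, b)).swap =
      (b, -(-a + (index (a, b) : ℝ) * b) + (index (mapFun (a, b)).swap : ℝ) * b) := rfl
    rw [e, hk]
    ext <;> simp
  rw [h]
  rfl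

/-- The BCZ map `T : Ω → Ω`, as a bijection of the Farey triangle; `T ^ n` is its `n`-th iterate
for every integer `n`. -/
noncomputable def T : Equiv.Perm Farey where
  toFun x := ⟨mapFun x, mapFun_mem x.2⟩
  invFun x := ⟨(mapFun x.1.swap).swap, swap_mem (mapFun_mem (swap_mem x.2))⟩
  left_inv x := Subtype.ext (swap_mapFun_swap_mapFun x.2)
  right_inv x := by
    have h := congrArg Prod.swap (swap_mapFun_swap_mapFun (swap_mem x.2))
    simpa using Subtype.ext (a1 := ⟨_, mapFun_mem (swap_mem (mapFun_mem (swap_mem x.2)))⟩) h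

/-- `k` as a function on `Ω`. -/
noncomputable def k (x : Farey) : ℤ := index x

/-- The symmetrized itinerary function `k̂ = (k + k ∘ T⁻¹) / 2`. -/
noncomputable def kHat (x : Farey) : ℝ := ((k x : ℝ) + (k (T⁻¹ x) : ℝ)) / 2

/-- The forward partial sum `∑_{i = 1}^{n} (k̂ ∘ T^{i - 1} - 3)`. -/
noncomputable def fHat (x : Farey) (n : ℕ) : ℝ :=
  ∑ i ∈ Finset.Icc 1 n, (kHat ((T ^ ((i : ℤ) - 1)) x) - 3)

/-- The backward partial sum `∑_{i = 0}^{n} (k̂ ∘ T^{-i - 1} - 3)`. -/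
noncomputable def fHatNeg (x : Farey) (n : ℕ) : ℝ :=
  ∑ i ∈ Finset.range (n + 1), (kHat ((T ^ (-(i : ℤ) - 1)) x) - 3)

/-- The Diophantine exponent of `s`, a supremum in the extended reals. -/
noncomputable def dioExp (s : ℝ) : EReal :=
  sSup {v : EReal | ∃ w : ℝ, v = w ∧
    {r : ℚ | |s - (r : ℝ)| < 1 / (r.den : ℝ) ^ w}.Infinite}

/-- The even Diophantine exponent `e⁺(s)`: approximation by rationals larger than `s`. -/
noncomputable def evenExp (s : ℝ) : EReal :=
  sSup {v : EReal | ∃ w : ℝ, v = w ∧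
    {r : ℚ | 0 < (r : ℝ) - s ∧ (r : ℝ) - s < 1 / (r.den : ℝ) ^ w}.Infinite}

/-- The odd Diophantine exponent `e⁻(s)`: approximation by rationals smaller than `s`. -/
noncomputable def oddExp (s : ℝ) : EReal :=
  sSup {v : EReal | ∃ w : ℝ, v = w ∧
    {r : ℚ | 0 < s - (r : ℝ) ∧ s - (r : ℝ) < 1 / (r.den : ℝ) ^ w}.Infinite}

open Classical in
/-- The quotient `(e - c) / e`, read as its limit `1` when `e = +∞`. -/
noncomputable def ratio (c : ℝ) (e : EReal) : ℝ :=
  if e = ⊤ then 1 else (e.toReal - c) / e.toReal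

/-- `limsup_{n → ∞} log |f n| / log n`, taken in the extended reals. -/
noncomputable def logSpeed (f : ℕ → ℝ) : EReal :=
  limsup (fun n : ℕ => ((Real.log |f n| / Real.log n : ℝ) : EReal)) atTop

end BCZ

/-! ### Orbits as ordered lists of primitive vectors in a strip -/

namespace BCZ

/-! Put `s = b/a`. The orbit of `(a, b)` lists the primitive vectors `(q, p)` with `q ≥ 0` and `0 <
a(qs - p) ≤ 1` in order of the slope `q / (a(qs - p))`; the coordinates of the orbit are the values
`α n` of this linear form (`exists_vec_eq`). The slope of the `n`-th vector lies between constant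
multiples of `n` (`le_slope`, `exists_slope_le`), so slope measures time.

To a unimodular pair (orbit vector, right neighbour) one attaches a `height`, the sum of `κ - 3`
with a boundary correction. It rises by `x` when `x` copies of the left vector are added to the
right one and drops by 1 when the right vector is added to the left one. Euclid's algorithm
therefore writes it as an alternating sum of partial quotients, up to a bounded starting value, in
logarithmically many blocks (`abs_height_le`). Each block is controlled by the quality of one
approximation, which gives the upper bound.

Conversely, a fraction below `s` with denominator `Q` and error about `Q^(-v)` is an orbit vector at
time at most of order `Q^v` with coordinate of order `Q^(1-v)`. Its index causes a single jump of
order `Q^(v-1)`, whence `(e⁻ - 1)/e⁻`. Such a fraction above `s` is not in the orbit, but it is the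
common right neighbour of a chain of about `Q^(v-2)` orbit vectors; the height drops by 1 at each,
within time of order `Q^v`, whence `(e⁺ - 2)/e⁺`. Symmetrizing the index keeps the boundary term
bounded along such a chain.

Backward time reduces to forward time through the swap of coordinates, which inverts `s` and
exchanges `e⁺` with `e⁻`. Almost everywhere both exponents equal 2. -/

/-- The determinant of two integer vectors. -/
def det (u w : ℤ × ℤ) : ℤ := u.1 * w.2 - u.2 * w.1

/-- A forward orbit of the BCZ map, through its coordinates `α` and its indices `κ`. -/
structure Orbit where
  α : ℕ → ℝ
  κ : ℕ → ℤ
  pos : ∀ n, 0 < α n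
  le_one : ∀ n, α n ≤ 1
  one_lt : ∀ n, 1 < α n + α (n + 1)
  add_eq : ∀ n, α n + α (n + 2) = κ (n + 1) * α (n + 1)

namespace Orbit

variable (o : Orbit)

/-- The linear form of which the orbit coordinates are values at integer vectors. -/
noncomputable def form (u : ℤ × ℤ) : ℝ := o.α 1 * u.1 - o.α 0 * u.2

/-- The integer vectors that correspond to the orbit coordinates. -/
def vec : ℕ → ℤ × ℤ
  | 0 => (0, -1)
  | 1 => (1, 0)
  | n + 2 => o.κ (n + 1) • vec (n + 1) - vec n

theorem vec_add_two (n : ℕ) : o.vec (n + 2) = o.κ (n + 1) • o.vec (n + 1) - o.vec n := rfl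

theorem form_add (u w : ℤ × ℤ) : o.form (u + w) = o.form u + o.form w := by
  simp [form]; ring

theorem form_smul (x : ℤ) (u : ℤ × ℤ) : o.form (x • u) = x * o.form u := by
  simp [form]; ring

theorem form_vec (n : ℕ) : o.form (o.vec n) = o.α n := by
  induction n using Nat.strong_induction_on with
  | _ n ih =>
    match n with
    | 0 => simp [form, vec]
    | 1 => simp [form, vec]
    | n + 2 =>
      have h1 := ih n (by omega)
      have h2 := ih (n + 1) (by omega)
      have h3 := o.add_eq n
      rw [vec_add_two, sub_eq_add_neg, form_add, form_smul, ← neg_one_smul ℤ, form_smul, h1, h2]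
      push_cast
      linarith

theorem det_vec_succ (n : ℕ) : det (o.vec n) (o.vec (n + 1)) = 1 := by
  induction n with
  | zero => simp [det, vec]
  | succ n ih =>
    rw [vec_add_two]
    simp only [det, Prod.fst_sub, Prod.snd_sub, Prod.smul_fst, Prod.smul_snd, smul_eq_mul] at ih ⊢
    linear_combination ih

/-- The source of nearly every size estimate: for a unimodular pair it ties the first coordinates to
the two values of the form. -/
theorem form_det (u w : ℤ × ℤ) :
    w.1 * o.form u - u.1 * o.form w = o.α 0 * (det u w : ℤ) := by
  simp [form, det]; ring

/-- The slope of the `n`-th vector of the orbit. -/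
noncomputable def slope (n : ℕ) : ℝ := (o.vec n).1 / o.α n

theorem slope_succ (n : ℕ) : o.slope (n + 1) = o.slope n + o.α 0 / (o.α n * o.α (n + 1)) := by
  have h := o.form_det (o.vec n) (o.vec (n + 1))
  rw [det_vec_succ, form_vec, form_vec] at h
  have h1 := (o.pos n).ne'
  have h2 := (o.pos (n + 1)).ne'
  simp only [slope]
  field_simp
  push_cast at h
  linarith

theorem slope_step (n : ℕ) : o.α 0 ≤ o.α 0 / (o.α n * o.α (n + 1)) := by
  rw [le_div_iff₀ (mul_pos (o.pos n) (o.pos (n + 1)))]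
  have := mul_le_one₀ (o.le_one n) (o.pos (n + 1)).le (o.le_one (n + 1))
  nlinarith [o.pos 0]

theorem slope_strictMono : StrictMono o.slope := by
  refine strictMono_nat_of_lt_succ fun n => ?_
  have := o.slope_step n
  have := o.pos 0
  rw [slope_succ]
  linarith

theorem le_slope (n : ℕ) : o.α 0 * n ≤ o.slope n := by
  induction n with
  | zero => simp [slope, vec]
  | succ n ih =>
    rw [slope_succ]
    have := o.slope_step n
    push_cast
    linarith

theorem slope_nonneg (n : ℕ) : 0 ≤ o.slope n :=
  le_trans (mul_nonneg (o.pos 0).le (Nat.cast_nonneg n)) (o.le_slope n)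

theorem vec_fst_pos {n : ℕ} (hn : 1 ≤ n) : 1 ≤ (o.vec n).1 := by
  have h1 : 0 < o.slope n :=
    lt_of_lt_of_le (mul_pos (o.pos 0) (by exact_mod_cast hn)) (o.le_slope n)
  have h2 : (0 : ℝ) < (o.vec n).1 := by
    have := mul_pos h1 (o.pos n)
    rwa [slope, div_mul_cancel₀ _ (o.pos n).ne'] at this
  have h3 : 0 < (o.vec n).1 := by exact_mod_cast h2
  omega

theorem vec_fst_nonneg (n : ℕ) : 0 ≤ (o.vec n).1 := by
  rcases Nat.eq_zero_or_pos n with rfl | h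
  · simp [vec]
  · have := o.vec_fst_pos h
    omega

theorem fst_div_lt_iff {u w : ℤ × ℤ} (hu : 0 < o.form u) (hw : 0 < o.form w) :
    (u.1 : ℝ) / o.form u < w.1 / o.form w ↔ 0 < det u w := by
  have h := o.form_det u w
  rw [div_lt_div_iff₀ hu hw]
  constructor
  · intro h1
    have : 0 < o.α 0 * (det u w : ℝ) := by linarith
    exact_mod_cast pos_of_mul_pos_right this (o.pos 0).le
  · intro h1
    have : 0 < o.α 0 * (det u w : ℝ) := mul_pos (o.pos 0) (by exact_mod_cast h1)
    linarith

theorem det_comm (u w : ℤ × ℤ) : det u w = -det w u := by simp [det]; ring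

theorem slope_eq (n : ℕ) : o.slope n = (o.vec n).1 / o.form (o.vec n) := by
  rw [slope, form_vec]

theorem form_vec_pos (n : ℕ) : 0 < o.form (o.vec n) := by rw [form_vec]; exact o.pos n

theorem form_vec_le (n : ℕ) : o.form (o.vec n) ≤ 1 := by rw [form_vec]; exact o.le_one n

theorem det_vec_pos_iff (i j : ℕ) : 0 < det (o.vec i) (o.vec j) ↔ i < j := by
  rw [← o.fst_div_lt_iff (o.form_vec_pos i) (o.form_vec_pos j), ← slope_eq, ← slope_eq]
  exact o.slope_strictMono.lt_iff_lt

/-- Cramer's rule in a unimodular basis. -/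
theorem eq_combination {p q : ℤ × ℤ} (h : det p q = 1) (u : ℤ × ℤ) :
    u = det u q • p + det p u • q := by
  simp only [det] at h ⊢
  ext
  · simp only [Prod.fst_add, Prod.smul_fst, smul_eq_mul]
    linear_combination -u.1 * h
  · simp only [Prod.snd_add, Prod.smul_snd, smul_eq_mul]
    linear_combination -u.2 * h

/-- Every primitive vector in the strip occurs in the orbit. -/
theorem exists_vec_eq {u w : ℤ × ℤ} (huw : det u w = 1) (h0 : 0 ≤ u.1) (hpos : 0 < o.form u)
    (hle : o.form u ≤ 1) : ∃ N, o.vec N = u := by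
  classical
  have hex : ∃ n, (u.1 : ℝ) / o.form u < o.slope n := by
    obtain ⟨n, hn⟩ := exists_nat_gt ((u.1 : ℝ) / o.form u / o.α 0)
    refine ⟨n, lt_of_lt_of_le ?_ (o.le_slope n)⟩
    rw [div_lt_iff₀ (o.pos 0)] at hn
    linarith
  -- The first index whose slope exceeds that of `u` places `u` in the cone between two consecutive
  -- orbit vectors.
  have hmin := fun m => Nat.find_min hex (m := m)
  have hspec := Nat.find_spec hex
  generalize Nat.find hex = n at hmin hspec
  have hne : n ≠ 0 := by
    rintro rfl
    have h1 : o.slope 0 = 0 := by simp [slope, vec]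
    rw [h1] at hspec
    have : 0 ≤ (u.1 : ℝ) / o.form u := div_nonneg (by exact_mod_cast h0) hpos.le
    linarith
  obtain ⟨i, rfl⟩ := Nat.exists_eq_succ_of_ne_zero hne
  have hi := hmin i (Nat.lt_succ_self i)
  rw [slope_eq, o.fst_div_lt_iff hpos (o.form_vec_pos _)] at hspec
  rw [slope_eq, o.fst_div_lt_iff hpos (o.form_vec_pos _), det_comm] at hi
  have hdet := o.det_vec_succ i
  have hu := eq_combination hdet u
  generalize hx : det u (o.vec (i + 1)) = x at *
  generalize hy : det (o.vec i) u = y at *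
  have hform := congrArg o.form hu
  rw [form_add, form_smul, form_smul, form_vec, form_vec] at hform
  -- A positive multiple of both neighbours would push the form above `α i + α (i + 1) > 1`, out of
  -- the strip.
  have hy0 : y = 0 := by
    by_contra hy0
    have h1 : (1 : ℝ) ≤ x := by exact_mod_cast hspec
    have h2 : (1 : ℝ) ≤ y := by
      have : 1 ≤ y := by omega
      exact_mod_cast this
    have := o.one_lt i
    have := o.pos i
    have := o.pos (i + 1)
    nlinarith
  rw [hy0, zero_smul, add_zero] at hu
  have hx1 : x = 1 := by
    have h1 : x * det (o.vec i) w = 1 := by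
      rw [← huw]
      conv_rhs => rw [hu]
      simp [det]; ring
    rcases Int.isUnit_iff.1 (IsUnit.of_mul_eq_one _ h1) with h | h <;> omega
  rw [hx1, one_smul] at hu
  exact ⟨i, hu.symm⟩

end Orbit
-- Linear growth of the slopes
/-- A correction that makes the growth of the sums of reciprocals of orbit coordinates linear. -/
noncomputable def correction (a b : ℝ) : ℝ :=
  if a < b then max (2 * (2 * b - 1)) 0 / (b - a) else 0

theorem correction_nonneg (a b : ℝ) : 0 ≤ correction a b := by
  unfold correction
  split_ifs with h
  · exact div_nonneg (le_max_right _ _) (by linarith)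
  · exact le_rfl

/-- A potential argument. A coordinate `c` below `1/3` arises only with index 1, as a difference `b
- a`. Before it, steps of index 2 form an increasing arithmetic progression with the same
difference, along which the potential rises by at most 4 per step; what has accumulated then pays
for `1 / c`. -/
theorem correction_step {a b c : ℝ} {k : ℤ} (ha : 0 < a) (ha1 : a ≤ 1) (hb : 0 < b) (hb1 : b ≤ 1)
    (hc : 0 < c) (hc1 : c ≤ 1) (hab : 1 < a + b) (hbc : 1 < b + c) (h : a + c = k * b) :
    correction b c + 1 / c ≤ correction a b + 10 := by
  have hk : 0 < k := by
    have : 0 < (k : ℝ) * b := by linarith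
    exact_mod_cast pos_of_mul_pos_left this hb.le
  rcases (by omega : k = 1 ∨ k = 2 ∨ 3 ≤ k) with rfl | rfl | hk3
  · have hcb : c = b - a := by push_cast at h; linarith
    have h1 : correction b c = 0 := if_neg (by linarith)
    rw [h1, zero_add]
    rcases le_or_gt c (1 / 4) with h4 | h4
    · have h2 : 1 / c ≤ correction a b := by
        rw [correction, if_pos (by linarith), ← hcb]
        gcongr
        exact le_max_of_le_left (by linarith)
      linarith
    · have : 1 / c ≤ 4 := by rw [div_le_iff₀ hc]; linarith
      have := correction_nonneg a b
      linarith
  · have hcb : c - b = b - a := by push_cast at h; linarith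
    have h3 : 1 / c ≤ 3 := by rw [div_le_iff₀ hc]; linarith
    by_cases hlt : a < b
    · have h1 : correction b c ≤ correction a b + 4 := by
        rw [correction, correction, if_pos hlt, if_pos (by linarith), hcb,
          div_add' _ _ _ (by linarith)]
        refine div_le_div_of_nonneg_right ?_ (by linarith)
        refine max_le ?_ ?_
        · have := le_max_left (2 * (2 * b - 1)) 0
          linarith
        · have := le_max_right (2 * (2 * b - 1)) 0
          linarith
      linarith
    · have h1 : correction b c = 0 := if_neg (by linarith)
      have := correction_nonneg a b
      linarith
  · have hk3' : (3 : ℝ) ≤ k := by exact_mod_cast hk3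
    have hb3 : 3 * b ≤ a + c := by nlinarith
    have h3 : 1 / c ≤ 3 := by rw [div_le_iff₀ hc]; linarith
    have h0 := correction_nonneg a b
    have h1 : correction b c ≤ 6 := by
      unfold correction
      split_ifs with hlt
      · rw [div_le_iff₀ (by linarith)]
        refine max_le ?_ (by linarith)
        rcases le_or_gt b (1 / 2) with hb2 | hb2
        · linarith
        · have hk4 : k < 4 := by
            have : (k : ℝ) < 4 := by nlinarith
            exact_mod_cast this
          have : k = 3 := by omega
          subst this
          push_cast at h
          linarith
      · norm_num
    linarith

namespace Orbit

variable (o : Orbit)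

theorem sum_inv_le (n : ℕ) :
    ∑ i ∈ Finset.range (n + 2), 1 / o.α i + correction (o.α n) (o.α (n + 1)) ≤
      1 / o.α 0 + 1 / o.α 1 + correction (o.α 0) (o.α 1) + 10 * n := by
  induction n with
  | zero => simp [Finset.sum_range_succ]
  | succ n ih =>
    have := correction_step (o.pos n) (o.le_one n) (o.pos (n + 1)) (o.le_one (n + 1))
      (o.pos (n + 2)) (o.le_one (n + 2)) (o.one_lt n) (o.one_lt (n + 1)) (o.add_eq n)
    rw [Finset.sum_range_succ]
    push_cast
    linarith

/-- Since `α 0 ≤ 1 < α n + α (n + 1)`, each slope increment is at most the sum of two neighbouring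
reciprocals, and every reciprocal is used at most twice. -/
theorem slope_le_sum (n : ℕ) : o.slope n ≤ 2 * ∑ i ∈ Finset.range (n + 1), 1 / o.α i := by
  have key : o.slope n + 1 / o.α n ≤ 2 * ∑ i ∈ Finset.range (n + 1), 1 / o.α i := by
    induction n with
    | zero =>
      have := one_div_pos.2 (o.pos 0)
      have h0 : o.slope 0 = 0 := by simp [slope, vec]
      rw [Finset.sum_range_one, h0]
      linarith
    | succ n ih =>
      rw [Finset.sum_range_succ, slope_succ]
      have h1 := o.pos n
      have h2 := o.pos (n + 1)
      have : o.α 0 / (o.α n * o.α (n + 1)) ≤ 1 / o.α n + 1 / o.α (n + 1) := by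
        rw [div_add_div _ _ h1.ne' h2.ne']
        gcongr
        linarith [o.le_one 0, o.one_lt n]
      linarith
  have := one_div_pos.2 (o.pos n)
  linarith

/-- The slope of the `n`-th vector grows at most linearly. -/
theorem exists_slope_le : ∃ C : ℝ, 1 ≤ C ∧ ∀ n : ℕ, 1 ≤ n → o.slope n ≤ C * n := by
  set D := 1 / o.α 0 + 1 / o.α 1 + correction (o.α 0) (o.α 1) with hD
  have h0 := one_div_pos.2 (o.pos 0)
  have h1 := one_div_pos.2 (o.pos 1)
  have h2 := correction_nonneg (o.α 0) (o.α 1)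
  refine ⟨2 * D + 20, by linarith, fun n hn => ?_⟩
  have h3 := o.slope_le_sum n
  have h4 := o.sum_inv_le n
  have h5 := correction_nonneg (o.α n) (o.α (n + 1))
  have h6 := one_div_pos.2 (o.pos (n + 1))
  rw [Finset.sum_range_succ] at h4
  have h7 : (1 : ℝ) ≤ n := by exact_mod_cast hn
  nlinarith

end Orbit
-- Heights of Farey pairs
theorem det_add_left (u v w : ℤ × ℤ) : det (u + v) w = det u w + det v w := by
  simp [det]; ring

theorem det_add_right (u v w : ℤ × ℤ) : det u (v + w) = det u v + det u w := by
  simp [det]; ring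

theorem det_smul_left (x : ℤ) (u w : ℤ × ℤ) : det (x • u) w = x * det u w := by
  simp [det]; ring

theorem det_smul_right (x : ℤ) (u w : ℤ × ℤ) : det u (x • w) = x * det u w := by
  simp [det]; ring

theorem det_self (u : ℤ × ℤ) : det u u = 0 := by
  simp [det]; ring

namespace Orbit

variable (o : Orbit)

theorem vec_add_vec (n : ℕ) : o.vec n + o.vec (n + 2) = o.κ (n + 1) • o.vec (n + 1) := by
  rw [vec_add_two]; abel

theorem κ_eq_det (n : ℕ) : o.κ (n + 1) = det (o.vec n) (o.vec (n + 2)) := by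
  rw [vec_add_two, sub_eq_add_neg, det_add_right, det_smul_right, det_vec_succ,
    ← neg_one_smul ℤ, det_smul_right, det_self]
  ring

/-- The sum of the centred indices strictly between two Farey neighbours. -/
theorem sum_Ioo_κ {N M : ℕ} (hNM : N < M) (h : det (o.vec N) (o.vec M) = 1) :
    ∑ i ∈ Finset.Ioo N M, (o.κ i - 3) =
      -det (o.vec (N + 1)) (o.vec M) - det (o.vec N) (o.vec (M - 1)) := by
  induction hd : M - N using Nat.strong_induction_on generalizing N M with
  | _ d ih =>
    rcases eq_or_ne M (N + 1) with rfl | hne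
    · have : Finset.Ioo N (N + 1) = ∅ := by ext; simp
      rw [this]
      simp [det_self]
    -- As `M ≠ N + 1`, the vector after `vec N` is `y • vec N + vec M` with `y ≥ 1`, and its form is
    -- at most 1. So the mediant lies in the strip and occurs in the orbit, and the induction splits
    -- there.
    · have hsum : o.α N + o.α M ≤ 1 := by
        have hy : 0 < det (o.vec (N + 1)) (o.vec M) := (o.det_vec_pos_iff _ _).2 (by omega)
        have h1 := congrArg o.form (eq_combination h (o.vec (N + 1)))
        rw [det_vec_succ, one_smul, form_add, form_smul, form_vec, form_vec, form_vec] at h1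
        have h2 : (1 : ℝ) ≤ (det (o.vec (N + 1)) (o.vec M) : ℤ) := by exact_mod_cast hy
        nlinarith [o.pos N, o.le_one (N + 1)]
      obtain ⟨J, hJ⟩ := o.exists_vec_eq (u := o.vec N + o.vec M) (w := o.vec M)
        (by rw [det_add_left, h, det_self]; rfl)
        (by simpa using add_nonneg (o.vec_fst_nonneg N) (o.vec_fst_nonneg M))
        (by rw [form_add, form_vec, form_vec]; linarith [o.pos N, o.pos M])
        (by rw [form_add, form_vec, form_vec]; linarith)
      have hNJ : det (o.vec N) (o.vec J) = 1 := by rw [hJ, det_add_right, h, det_self]; rfl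
      have hJM : det (o.vec J) (o.vec M) = 1 := by rw [hJ, det_add_left, h, det_self]; rfl
      have hlt1 : N < J := (o.det_vec_pos_iff _ _).1 (by omega)
      have hlt2 : J < M := (o.det_vec_pos_iff _ _).1 (by omega)
      have ih1 := ih (J - N) (by omega) hlt1 hNJ rfl
      have ih2 := ih (M - J) (by omega) hlt2 hJM rfl
      have hsplit : Finset.Ioo N M = insert J (Finset.Ioo N J ∪ Finset.Ioo J M) := by
        ext i; simp; omega
      rw [hsplit, Finset.sum_insert (by simp), Finset.sum_union, ih1, ih2]
      · obtain ⟨j, rfl⟩ := Nat.exists_eq_succ_of_ne_zero (by omega : J ≠ 0)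
        simp only [Nat.succ_eq_add_one, Nat.add_sub_cancel] at *
        have e1 : det (o.vec (N + 1)) (o.vec (j + 1)) =
            -1 + det (o.vec (N + 1)) (o.vec M) := by
          rw [hJ, det_add_right, det_comm, det_vec_succ]
        have e2 : det (o.vec (j + 1)) (o.vec (M - 1)) =
            det (o.vec N) (o.vec (M - 1)) - 1 := by
          have := o.det_vec_succ (M - 1)
          rw [Nat.sub_add_cancel (by omega)] at this
          rw [hJ, det_add_left, det_comm (o.vec M), this]
          ring
        -- This explains the centring at 3: the mediant's index and the two halves each leave a
        -- surplus of 1.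
        have e3 : o.κ (j + 1) =
            det (o.vec N) (o.vec j) + det (o.vec (j + 2)) (o.vec M) + 1 := by
          have h1 := congrArg (det (o.vec N)) (o.vec_add_vec j)
          rw [det_smul_right, det_add_right, hNJ] at h1
          have h2 := o.det_vec_succ (j + 1)
          rw [hJ, det_add_left, det_comm (o.vec M)] at h2
          have h3 : j + 1 + 1 = j + 2 := rfl
          rw [h3] at h2
          linarith
        have h3 : j + 1 + 1 = j + 2 := rfl
        rw [e1, e2, e3, h3]
        ring
      · rw [Finset.disjoint_left]
        intro i; simp; omega

/-- The centred sum of indices up to the left end of a pair of Farey neighbours, corrected so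
that it depends on that pair only. -/
noncomputable def height (N : ℕ) (w : ℤ × ℤ) : ℤ :=
  ∑ i ∈ Finset.Icc 1 N, (o.κ i - 3) - det (o.vec (N + 1)) w

theorem height_succ (N : ℕ) :
    o.height N (o.vec (N + 1)) = ∑ i ∈ Finset.Icc 1 N, (o.κ i - 3) := by
  rw [height, det_self, sub_zero]

theorem height_add_smul (N : ℕ) (w : ℤ × ℤ) (x : ℤ) :
    o.height N (w + x • o.vec N) = o.height N w + x := by
  rw [height, height, det_add_right, det_smul_right, det_comm _ (o.vec N), det_vec_succ]
  ring

/-- With `height_add_smul`, this covers both elementary moves of Euclid's algorithm and makes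
partial quotients enter the height with alternating signs. The sum over the indices passed between
the two left ends comes from `sum_Ioo_κ`. -/
theorem height_of_eq_add {N M : ℕ} {w : ℤ × ℤ} (hw : det (o.vec N) w = 1)
    (hM : o.vec M = o.vec N + w) : o.height M w = o.height N w - 1 := by
  have hNM : det (o.vec N) (o.vec M) = 1 := by rw [hM, det_add_right, hw, det_self]; rfl
  have hlt : N < M := (o.det_vec_pos_iff _ _).1 (by omega)
  obtain ⟨m, rfl⟩ := Nat.exists_eq_succ_of_ne_zero (by omega : M ≠ 0)
  have hs := o.sum_Ioo_κ hlt hNM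
  simp only [Nat.succ_eq_add_one, Nat.add_sub_cancel] at *
  have hsplit : Finset.Icc 1 (m + 1) =
      insert (m + 1) (Finset.Icc 1 N ∪ Finset.Ioo N (m + 1)) := by
    ext i; simp; omega
  have hdisj : Disjoint (Finset.Icc 1 N) (Finset.Ioo N (m + 1)) := by
    rw [Finset.disjoint_left]
    intro i; simp; omega
  rw [height, height, hsplit, Finset.sum_insert (by simp; omega), Finset.sum_union hdisj, hs,
    κ_eq_det]
  have e1 := o.det_vec_succ (m + 1)
  have e0 := o.det_vec_succ m
  have e2 := o.det_vec_succ N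
  have e3 : m + 1 + 1 = m + 2 := rfl
  rw [e3] at e1 ⊢
  have h1 : det (o.vec (N + 1)) (o.vec (m + 1)) = -1 + det (o.vec (N + 1)) w := by
    rw [hM, det_add_right, det_comm, det_vec_succ]
  have h2 : det (o.vec m) (o.vec (m + 2)) =
      1 + det (o.vec N) (o.vec m) + det (o.vec (m + 2)) w := by
    have h3 := congrArg (det (o.vec N)) (o.vec_add_vec m)
    rw [det_smul_right, det_add_right, hNM, κ_eq_det] at h3
    rw [hM, det_add_left, det_comm w] at e1
    linarith
  rw [h1, h2]
  ring

/-- The height along a chain of vectors in the strip with a common right neighbour. -/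
theorem exists_height_eq_sub {N : ℕ} {w : ℤ × ℤ} (hw : det (o.vec N) w = 1) (hw0 : 0 ≤ w.1)
    (x : ℕ) (hx : ∀ y : ℕ, y ≤ x → 0 < o.form (o.vec N + (y : ℤ) • w) ∧
      o.form (o.vec N + (y : ℤ) • w) ≤ 1) :
    ∃ M, o.vec M = o.vec N + (x : ℤ) • w ∧ o.height M w = o.height N w - x := by
  induction x with
  | zero => exact ⟨N, by simp, by simp⟩
  | succ x ih =>
    obtain ⟨M, hM, hH⟩ := ih fun y hy => hx y (by omega)
    have h1 := hx (x + 1) le_rfl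
    have hMw : det (o.vec M) w = 1 := by
      rw [hM, det_add_left, hw, det_smul_left, det_self]; ring
    have hadd : o.vec N + ((x + 1 : ℕ) : ℤ) • w = o.vec M + w := by
      rw [hM]; push_cast; rw [add_smul, one_smul]; abel
    rw [hadd] at h1 ⊢
    obtain ⟨K, hK⟩ := o.exists_vec_eq (u := o.vec M + w) (w := w)
      (by rw [det_add_left, hMw, det_self]; rfl)
      (by simpa using add_nonneg (o.vec_fst_nonneg M) hw0) h1.1 h1.2
    refine ⟨K, hK, ?_⟩
    rw [o.height_of_eq_add hMw hK, hH]
    push_cast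
    ring

end Orbit
-- Bounds for one block of Euclid's algorithm
-- With `m = x Q l ≤ 2` one has `x = m / (Q l)` and `m (Q / l) = x Q²`. Since `m ≤ 2 m ^ θ`, the
-- factor `m` can be moved inside the power, so that a block cut short is measured against the time
-- `t` it has used.
theorem block_bound {x Q l θ C t : ℝ} (hx : 0 < x) (hQ : 0 < Q) (hl : 0 < l) (hxl : x * Q * l ≤ 2)
    (hθ0 : 0 ≤ θ) (hθ1 : θ ≤ 1) (hC : 0 ≤ C) (h : 1 / (Q * l) ≤ C * (Q / l) ^ θ)
    (ht : x * Q ^ 2 ≤ t) : x ≤ 2 * C * t ^ θ := by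
  set m := x * Q * l with hm
  have hm0 : 0 < m := by positivity
  have h1 : x = m * (1 / (Q * l)) := by rw [hm]; field_simp
  have h2 : m ≤ 2 * m ^ θ := by
    have h3 : m / 2 ≤ (m / 2) ^ θ := by
      conv_lhs => rw [← Real.rpow_one (m / 2)]
      exact Real.rpow_le_rpow_of_exponent_ge (by positivity) (by linarith) hθ1
    have h4 : (m / 2) ^ θ ≤ m ^ θ := Real.rpow_le_rpow (by positivity) (by linarith) hθ0
    linarith
  calc x = m * (1 / (Q * l)) := h1
    _ ≤ (2 * m ^ θ) * (C * (Q / l) ^ θ) := by gcongr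
    _ = 2 * C * (m * (Q / l)) ^ θ := by
        rw [Real.mul_rpow hm0.le (by positivity)]; ring
    _ = 2 * C * (x * Q ^ 2) ^ θ := by
        congr 2; rw [hm]; field_simp
    _ ≤ 2 * C * t ^ θ := by gcongr

theorem mul_rpow_le {c t θ : ℝ} (hc : 1 ≤ c) (ht : 0 ≤ t) (hθ1 : θ ≤ 1) :
    (c * t) ^ θ ≤ c * t ^ θ := by
  rw [Real.mul_rpow (by linarith) ht]
  gcongr
  conv_rhs => rw [← Real.rpow_one c]
  exact Real.rpow_le_rpow_of_exponent_le hc hθ1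

namespace Orbit

variable (o : Orbit)

/-- The approximations from below are not too good. -/
def LowerBound (C θ : ℝ) : Prop :=
  ∀ u w : ℤ × ℤ, det u w = 1 → 1 ≤ u.1 → 0 < o.form u → o.form u ≤ 1 →
    1 / o.form u ≤ C * (u.1 / o.form u) ^ θ

/-- The approximations from above are not too good. -/
def UpperBound (C θ : ℝ) : Prop :=
  ∀ u w : ℤ × ℤ, det u w = 1 → 1 ≤ w.1 → o.form w < 0 → -o.form w ≤ 1 →
    1 / (w.1 * -o.form w) ≤ C * (w.1 / -o.form w) ^ θ

theorem form_sub_smul (u w : ℤ × ℤ) (x : ℤ) :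
    o.form (u - x • w) = o.form u - x * o.form w := by
  simp [form]; ring

theorem vec_injective : Function.Injective o.vec := by
  intro i j h
  by_contra hne
  rcases Nat.lt_or_gt_of_ne hne with h1 | h1
  · have := (o.det_vec_pos_iff i j).2 h1
    rw [h, det_self] at this
    omega
  · have := (o.det_vec_pos_iff j i).2 h1
    rw [h, det_self] at this
    omega

/-- Walking back along `w` does not leave the strip. One of the two bounds follows by monotonicity,
according to the sign of the form at `w`; the other follows from `form_det`. -/
theorem form_left_bounds {u w : ℤ × ℤ} (h : det u w = 1) (hu1 : 0 ≤ u.1) (hw1 : 1 ≤ w.1)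
    {x : ℝ} (hx : 0 ≤ x)
    (hpos : 0 < o.form u + x * o.form w) (hle : o.form u + x * o.form w ≤ 1) :
    0 < o.form u ∧ o.form u ≤ 1 := by
  have h1 := o.form_det u w
  rw [h] at h1
  push_cast at h1
  have hw1' : (1 : ℝ) ≤ w.1 := by exact_mod_cast hw1
  have hu1' : (0 : ℝ) ≤ u.1 := by exact_mod_cast hu1
  have ha := o.pos 0
  have ha1 := o.le_one 0
  rcases le_or_gt 0 (o.form w) with hw | hw
  · constructor
    · by_contra hneg
      nlinarith [mul_nonneg hu1' hw]
    · nlinarith [mul_nonneg hx hw]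
  · constructor
    · nlinarith
    · by_contra hneg
      nlinarith [mul_nonneg hu1' (neg_pos.2 hw).le]

/-- Going back by a multiple of the right end of a pair of Farey neighbours. -/
theorem exists_vec_sub_smul {N : ℕ} {w : ℤ × ℤ} (h : det (o.vec N) w = 1) (hw1 : 1 ≤ w.1)
    (x : ℕ) (hx : 0 ≤ (o.vec N).1 - x * w.1) :
    ∃ N', o.vec N' = o.vec N - (x : ℤ) • w ∧ o.height N w = o.height N' w - x := by
  set u := o.vec N - (x : ℤ) • w with hu
  have huN : o.vec N = u + (x : ℤ) • w := by rw [hu]; abel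
  have hdet : det u w = 1 := by
    rw [hu, sub_eq_add_neg, ← neg_smul, det_add_left, det_smul_left, det_self, h]; ring
  have hu1 : 0 ≤ u.1 := by simpa [hu] using hx
  have hform : o.form u + (x : ℝ) * o.form w = o.α N := by
    rw [← form_vec, huN, form_add, form_smul]; push_cast; ring
  obtain ⟨hpos, hle⟩ := o.form_left_bounds hdet hu1 hw1 (x := x) (Nat.cast_nonneg x)
    (by rw [hform]; exact o.pos N) (by rw [hform]; exact o.le_one N)
  obtain ⟨N', hN'⟩ := o.exists_vec_eq hdet hu1 hpos hle
  refine ⟨N', hN', ?_⟩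
  -- The form is affine in `y`, so it stays between its values at the two ends.
  have hbd : ∀ y : ℕ, y ≤ x → 0 < o.form (o.vec N' + (y : ℤ) • w) ∧
      o.form (o.vec N' + (y : ℤ) • w) ≤ 1 := by
    intro y hy
    rw [hN', form_add, form_smul]
    have hy' : (y : ℝ) ≤ x := by exact_mod_cast hy
    have hy0 : (0 : ℝ) ≤ y := Nat.cast_nonneg y
    have := o.pos N
    have := o.le_one N
    push_cast
    rcases le_or_gt 0 (o.form w) with hw | hw
    · constructor <;> nlinarith [mul_le_mul_of_nonneg_right hy' hw, mul_nonneg hy0 hw]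
    · constructor <;> nlinarith [mul_le_mul_of_nonneg_right hy' (neg_pos.2 hw).le,
        mul_nonneg hy0 (neg_pos.2 hw).le]
  obtain ⟨M, hM, hH⟩ := o.exists_height_eq_sub (N := N') (by rw [hN', hdet])
    (by omega) x hbd
  rw [hN', ← huN] at hM
  rw [← o.vec_injective hM, hH]

/-- The height of a pair whose right end is vertical. -/
theorem height_vertical {N : ℕ} {w : ℤ × ℤ} (hN : 1 ≤ N) (h : det (o.vec N) w = 1)
    (hw1 : w.1 = 0) : ∃ p : ℕ, o.vec N = (1, (p : ℤ)) ∧ (p : ℝ) ≤ o.α 1 / o.α 0 ∧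
      o.height N w = -3 - p := by
  have hQ := o.vec_fst_pos hN
  have h1 : (o.vec N).1 * w.2 = 1 := by rw [← h]; simp [det, hw1]
  have hQ1 : (o.vec N).1 = 1 := by
    rcases Int.isUnit_iff.1 (IsUnit.of_mul_eq_one _ h1) with h | h <;> omega
  have hw : w = (0, 1) := by
    rw [hQ1, one_mul] at h1
    exact Prod.ext hw1 h1
  subst hw
  have hform := o.form_vec N
  simp only [form, hQ1] at hform
  push_cast at hform
  have hP : 0 ≤ (o.vec N).2 := by
    by_contra hneg
    have : ((o.vec N).2 : ℝ) ≤ -1 := by exact_mod_cast (by omega : (o.vec N).2 ≤ -1)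
    have h3 := o.one_lt 0
    have := o.le_one N
    have := o.pos 0
    rw [zero_add] at h3
    nlinarith
  obtain ⟨p, hp⟩ := Int.eq_ofNat_of_zero_le hP
  have hp' : ((o.vec N).2 : ℝ) = p := by rw [hp]; rfl
  rw [hp'] at hform
  have hpos := o.pos N
  have ha := o.pos 0
  have hv : o.vec N = (1, (p : ℤ)) := Prod.ext hQ1 hp
  refine ⟨p, hv, ?_, ?_⟩
  · rw [le_div_iff₀ ha]; linarith
  -- The pair is reached from `vec 1 = (1, 0)` by `p` moves along `(0, 1)`; the starting height is
  -- -3, since `κ 1` cancels against the determinant.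
  · have hbd : ∀ y : ℕ, y ≤ p → 0 < o.form (o.vec 1 + (y : ℤ) • ((0, 1) : ℤ × ℤ)) ∧
        o.form (o.vec 1 + (y : ℤ) • ((0, 1) : ℤ × ℤ)) ≤ 1 := by
      intro y hy
      have hy' : (y : ℝ) ≤ p := by exact_mod_cast hy
      have hy0 : (0 : ℝ) ≤ y := Nat.cast_nonneg y
      have hb := o.le_one 1
      rw [form_add, form_vec, form_smul]
      simp only [form]
      push_cast
      constructor <;> nlinarith
    obtain ⟨M, hM, hH⟩ := o.exists_height_eq_sub (N := 1) (w := (0, 1))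
      (by simp [det, vec]) (by simp) p hbd
    have : o.vec M = o.vec N := by rw [hM, hv]; simp [vec]
    rw [← o.vec_injective this, hH]
    simp [height, det, vec]

theorem left_block_le {C θ t : ℝ} (hθ0 : 0 ≤ θ) (hC : 0 ≤ C)
    (hlow : o.LowerBound C θ) {N : ℕ} (hN : 1 ≤ N) (ht : o.slope N ≤ t) {w : ℤ × ℤ}
    (h : det (o.vec N) w = 1) (hw0 : 0 ≤ w.1) {x : ℕ}
    (hle : o.form (w + (x : ℤ) • o.vec N) ≤ 1) : (x : ℝ) ≤ 2 * C * t ^ θ := by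
  have h1 := o.form_det (o.vec N) w
  rw [h, form_vec] at h1
  rw [form_add, form_smul, form_vec] at hle
  push_cast at h1 hle
  have hl := o.pos N
  have hQ : (1 : ℝ) ≤ (o.vec N).1 := by exact_mod_cast o.vec_fst_pos hN
  have hw0' : (0 : ℝ) ≤ w.1 := by exact_mod_cast hw0
  have h2 : -o.form w ≤ 1 := by
    by_contra hneg
    have := o.le_one 0
    nlinarith [mul_nonneg hw0' hl.le]
  have h3 : (x : ℝ) ≤ 2 * (1 / o.α N) := by
    rw [mul_one_div, le_div_iff₀ hl]; linarith
  have h4 := hlow _ _ h (o.vec_fst_pos hN) (o.form_vec_pos N) (o.form_vec_le N)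
  rw [form_vec] at h4
  have h5 : ((o.vec N).1 / o.α N : ℝ) ^ θ ≤ t ^ θ :=
    Real.rpow_le_rpow (o.slope_nonneg N) ht hθ0
  nlinarith [mul_le_mul_of_nonneg_left h5 hC]

/-- If the form is negative at `w`, then `w` is an approximation from above and `UpperBound` applies
through `block_bound`. If it is positive, `w` is itself in the strip and `LowerBound` applies to it:
directly when `x * form w` dominates `α N'`, through `block_bound` otherwise. -/
theorem right_block_le {C θ t : ℝ} (hθ0 : 0 ≤ θ) (hθ1 : θ ≤ 1) (hC : 1 ≤ C)
    (hlow : o.LowerBound C θ) (hupp : o.UpperBound C θ) (hw : ∀ w : ℤ × ℤ, 1 ≤ w.1 → o.form w ≠ 0)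
    {N N' : ℕ} (ht1 : 1 ≤ t) (ht : o.slope N ≤ t) {w : ℤ × ℤ} {x : ℕ}
    (h : o.vec N = o.vec N' + (x : ℤ) • w) (hdet : det (o.vec N') w = 1) (hw1 : 1 ≤ w.1)
    (hle : o.form w ≤ 1) (hQ' : (o.vec N').1 ≤ w.1) :
    (x : ℝ) ≤ 8 * C * t ^ θ := by
  have htθ : 1 ≤ t ^ θ := Real.one_le_rpow ht1 hθ0
  rcases Nat.lt_or_ge x 2 with hx2 | hx2
  · have : (x : ℝ) ≤ 1 := by exact_mod_cast (by omega : x ≤ 1)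
    nlinarith
  have hx2' : (2 : ℝ) ≤ x := by exact_mod_cast hx2
  have hwQ : (1 : ℝ) ≤ w.1 := by exact_mod_cast hw1
  have hQN' : (0 : ℝ) ≤ (o.vec N').1 := by exact_mod_cast o.vec_fst_nonneg N'
  have hQ'' : ((o.vec N').1 : ℝ) ≤ w.1 := by exact_mod_cast hQ'
  have hd := o.form_det (o.vec N') w
  rw [hdet, form_vec] at hd
  have hform := o.form_vec N
  rw [h, form_add, form_smul, form_vec] at hform
  have hQN : ((o.vec N).1 : ℝ) = (o.vec N').1 + x * w.1 := by rw [h]; simp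
  rw [slope, hQN, div_le_iff₀ (o.pos N)] at ht
  push_cast at hd hform
  have hp := o.pos N
  have hp' := o.pos N'
  have ha := o.pos 0
  have ha1 := o.le_one 0
  rcases lt_or_gt_of_ne (hw w hw1) with hneg | hposw
  · set l := -o.form w with hl
    have hl0 : 0 < l := by linarith
    have hfw : o.form w = -l := by linarith
    rw [hfw] at hd hform
    have hQL : (w.1 : ℝ) * o.α N' ≤ 1 := by nlinarith [mul_nonneg hQN' hl0.le]
    have hxl : x * w.1 * l ≤ 1 := by nlinarith
    have hl1 : l ≤ 1 := by
      have : l ≤ x * w.1 * l := le_mul_of_one_le_left hl0.le (by nlinarith)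
      linarith
    have hαle : o.α N ≤ o.α N' := by nlinarith
    have hxQ : x * (w.1 : ℝ) ^ 2 ≤ t := by
      have h1 : x * (w.1 : ℝ) ≤ t * o.α N' := by nlinarith
      nlinarith
    have := block_bound (by linarith) (by linarith) hl0 (by linarith) hθ0 hθ1 (by linarith)
      (hupp _ _ hdet hw1 hneg hl1) hxQ
    have h5 : 0 ≤ C * t ^ θ := by positivity
    linarith
  · set l := o.form w with hl
    have hz : det w ((-1 : ℤ) • o.vec N') = 1 := by
      rw [det_smul_right, det_comm, hdet]; rfl
    have hlow' := hlow _ _ hz hw1 hposw hle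
    rw [← hl] at hlow'
    rcases le_or_gt (o.α N') (x * l) with hcase | hcase
    · have h1 : (w.1 : ℝ) / l ≤ 2 * t := by
        rw [div_le_iff₀ hposw]
        have h0 : x * (w.1 : ℝ) ≤ t * o.α N := by linarith
        have h1 : t * o.α N ≤ t * (2 * (x * l)) :=
          mul_le_mul_of_nonneg_left (by linarith) (by linarith)
        have h2 : x * (w.1 : ℝ) ≤ x * (2 * t * l) := by linarith
        exact le_of_mul_le_mul_left h2 (by linarith)
      have h2 : ((w.1 : ℝ) / l) ^ θ ≤ 2 * t ^ θ :=
        (Real.rpow_le_rpow (by positivity) h1 hθ0).trans (mul_rpow_le (by norm_num) (by linarith) hθ1)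
      have h3 : (x : ℝ) ≤ 1 / l := by
        rw [le_div_iff₀ hposw]; linarith [o.le_one N]
      have h4 := mul_le_mul_of_nonneg_left h2 (by linarith : 0 ≤ C)
      have h5 : 0 ≤ C * t ^ θ := by positivity
      linarith
    · have hl2 : 2 * l ≤ o.α N' := by nlinarith
      have hQL : (w.1 : ℝ) * o.α N' ≤ 2 := by nlinarith
      have hxl : x * w.1 * l ≤ 2 := by nlinarith
      have hxQ : x * (w.1 : ℝ) ^ 2 ≤ 4 * t := by
        have h0 : t * o.α N ≤ t * (2 * o.α N') :=
          mul_le_mul_of_nonneg_left (by linarith) (by linarith)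
        have h1 : x * (w.1 : ℝ) ≤ 2 * t * o.α N' := by linarith
        have h2 := mul_le_mul_of_nonneg_right h1 (by linarith : (0 : ℝ) ≤ w.1)
        have h3 := mul_le_mul_of_nonneg_left hQL (by linarith : 0 ≤ 2 * t)
        linarith
      have h3 : 1 / ((w.1 : ℝ) * l) ≤ C * (w.1 / l) ^ θ := by
        refine le_trans ?_ hlow'
        gcongr
        nlinarith
      have := block_bound (by linarith) (by linarith) hposw hxl hθ0 hθ1 (by linarith) h3 hxQ
      have h4 := mul_rpow_le (by norm_num : (1 : ℝ) ≤ 4) (by linarith : 0 ≤ t) hθ1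
      have h5 := mul_le_mul_of_nonneg_left h4 (by linarith : 0 ≤ 2 * C)
      linarith

end Orbit
-- Upper bound for the sums
theorem log_two_step {m n : ℤ} (hm : 0 ≤ m) (h : 2 * (m + 1) ≤ n + 1) :
    ((Nat.log 2 (m.toNat + 1) : ℕ) : ℝ) + 1 ≤ (Nat.log 2 (n.toNat + 1) : ℕ) := by
  have h1 : Nat.log 2 ((m.toNat + 1) * 2) ≤ Nat.log 2 (n.toNat + 1) :=
    Nat.log_mono_right (by omega)
  rw [Nat.log_mul_base (by norm_num) (by omega)] at h1
  exact_mod_cast h1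

namespace Orbit

variable (o : Orbit)

/-- Euclid's algorithm on the first coordinates of the pair: each division changes the height by a
quotient at most `B` and at least halves one coordinate plus one, so one binary logarithm falls by
1. The 3 on the left is the height -3 at the vertical end. -/
theorem abs_height_le {C θ t B : ℝ} (hθ0 : 0 ≤ θ) (hθ1 : θ ≤ 1) (hC : 1 ≤ C)
    (hlow : o.LowerBound C θ) (hupp : o.UpperBound C θ)
    (hirr : ∀ w : ℤ × ℤ, 1 ≤ w.1 → o.form w ≠ 0) (ht1 : 1 ≤ t)
    (hB : 8 * C * t ^ θ ≤ B) (hB1 : 1 ≤ B) (hB' : o.α 1 / o.α 0 ≤ B) {N : ℕ} {w : ℤ × ℤ}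
    (hN : 1 ≤ N) (hdet : det (o.vec N) w = 1) (hw0 : 0 ≤ w.1) (hle : o.form w ≤ 1)
    (ht : o.slope N ≤ t) :
    |(o.height N w : ℝ) + 3| ≤ B * (3 + (Nat.log 2 ((o.vec N).1.toNat + 1) : ℕ) +
      (Nat.log 2 (w.1.toNat + 1) : ℕ)) := by
  induction hd : ((o.vec N).1 + w.1).toNat using Nat.strong_induction_on generalizing N w with
  | _ d ih =>
    have hQ := o.vec_fst_pos hN
    have hlog1 : (0 : ℝ) ≤ (Nat.log 2 ((o.vec N).1.toNat + 1) : ℕ) := Nat.cast_nonneg _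
    have hlog2 : (0 : ℝ) ≤ (Nat.log 2 (w.1.toNat + 1) : ℕ) := Nat.cast_nonneg _
    have hBlog : B * 3 ≤ B * (3 + (Nat.log 2 ((o.vec N).1.toNat + 1) : ℕ) +
        (Nat.log 2 (w.1.toNat + 1) : ℕ)) := by gcongr; linarith
    have hCt : 0 ≤ C * t ^ θ := by positivity
    rcases (by omega : w.1 = 0 ∨ w.1 = 1 ∨ 2 ≤ w.1) with hw | hw | hw
    · obtain ⟨p, -, hp, hH⟩ := o.height_vertical hN hdet hw
      rw [hH]
      push_cast
      rw [abs_le]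
      have : (0 : ℝ) ≤ p := Nat.cast_nonneg p
      constructor <;> linarith
    -- A full division would end at remainder 0, that is at index 0. Stopping at remainder 1 keeps
    -- the left end at a positive index; one more move then makes the right end vertical.
    · obtain ⟨x, hx⟩ := Int.eq_ofNat_of_zero_le (by omega : 0 ≤ (o.vec N).1 - 1)
      obtain ⟨N', hN', hH⟩ := o.exists_vec_sub_smul hdet (by omega) x
        (by rw [hw]; omega)
      have hfst : (o.vec N').1 = 1 := by
        rw [hN']
        simp only [Prod.fst_sub, Prod.smul_fst, smul_eq_mul, hw]
        omega
      have hN1 : 1 ≤ N' := by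
        rcases Nat.eq_zero_or_pos N' with rfl | h
        · simp [vec] at hfst
        · exact h
      have hdet' : det (o.vec N') w = 1 := by
        rw [hN', sub_eq_add_neg, ← neg_smul, det_add_left, det_smul_left, det_self, hdet]; ring
      have hx := o.right_block_le hθ0 hθ1 hC hlow hupp hirr ht1 ht (x := x)
        (by rw [hN']; abel) hdet' (by omega) hle (by omega)
      obtain ⟨p, -, hp, hH'⟩ := o.height_vertical (w := w + (-1 : ℤ) • o.vec N') hN1
        (by rw [det_add_right, det_smul_right, det_self, hdet']; rfl)
        (by simp [hw, hfst])
      rw [height_add_smul] at hH'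
      have hH2 : o.height N w = -2 - p - x := by omega
      rw [hH2]
      push_cast
      rw [abs_le]
      have : (0 : ℝ) ≤ p := Nat.cast_nonneg p
      have : (0 : ℝ) ≤ x := Nat.cast_nonneg x
      constructor <;> linarith
    · rcases le_or_gt w.1 (o.vec N).1 with hcase | hcase
      · obtain ⟨x, hx⟩ := Int.eq_ofNat_of_zero_le
          (Int.ediv_nonneg (by omega) hw0 : 0 ≤ (o.vec N).1 / w.1)
        have hmod := Int.emod_add_mul_ediv (o.vec N).1 w.1
        rw [hx, mul_comm] at hmod
        have hm0 := Int.emod_nonneg (o.vec N).1 (by omega : w.1 ≠ 0)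
        have hm1 := Int.emod_lt_of_pos (o.vec N).1 (by omega : 0 < w.1)
        obtain ⟨N', hN', hH⟩ := o.exists_vec_sub_smul hdet (by omega) x (by omega)
        have hfst : (o.vec N').1 = (o.vec N).1 % w.1 := by
          rw [hN']
          simp only [Prod.fst_sub, Prod.smul_fst, smul_eq_mul]
          omega
        have hdet' : det (o.vec N') w = 1 := by
          rw [hN', sub_eq_add_neg, ← neg_smul, det_add_left, det_smul_left, det_self, hdet]; ring
        have hN1 : 1 ≤ N' := by
          rcases Nat.eq_zero_or_pos N' with rfl | h
          · simp [vec, det] at hdet'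
            omega
          · exact h
        have hle' : N' ≤ N := by
          by_contra hlt
          have h1 := (o.det_vec_pos_iff N N').2 (by omega)
          rw [hN', sub_eq_add_neg, ← neg_smul, det_add_right, det_smul_right, det_self, hdet] at h1
          omega
        have hxB := o.right_block_le hθ0 hθ1 hC hlow hupp hirr ht1 ht (x := x)
          (by rw [hN']; abel) hdet' (by omega) hle (by omega)
        have hIH := ih _ (by omega) hN1 hdet' hw0 hle
          ((o.slope_strictMono.monotone hle').trans ht) rfl
        have hstep := log_two_step (m := (o.vec N').1) (n := (o.vec N).1) (by omega) (by
          have : 1 ≤ (x : ℤ) := by rw [← hx]; exact Int.le_ediv_of_mul_le (by omega) (by omega)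
          nlinarith)
        rw [hH]
        push_cast
        rw [abs_le] at hIH ⊢
        have hx0 : (0 : ℝ) ≤ x := Nat.cast_nonneg x
        have := mul_le_mul_of_nonneg_left hstep (by linarith : 0 ≤ B)
        constructor <;> linarith
      · obtain ⟨x, hx⟩ := Int.eq_ofNat_of_zero_le
          (Int.ediv_nonneg hw0 (by omega) : 0 ≤ w.1 / (o.vec N).1)
        have hmod := Int.emod_add_mul_ediv w.1 (o.vec N).1
        rw [hx, mul_comm] at hmod
        have hm0 := Int.emod_nonneg w.1 (by omega : (o.vec N).1 ≠ 0)
        have hm1 := Int.emod_lt_of_pos w.1 (by omega : 0 < (o.vec N).1)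
        obtain ⟨w', hw'⟩ : ∃ w', w' = w - (x : ℤ) • o.vec N := ⟨_, rfl⟩
        have hww : w = w' + (x : ℤ) • o.vec N := by rw [hw']; abel
        have hfst : w'.1 = w.1 % (o.vec N).1 := by
          rw [hw']
          simp only [Prod.fst_sub, Prod.smul_fst, smul_eq_mul]
          omega
        have hdet' : det (o.vec N) w' = 1 := by
          rw [hw', sub_eq_add_neg, ← neg_smul, det_add_right, det_smul_right, det_self, hdet]; ring
        have hle' : o.form w' ≤ 1 := by
          rw [hw', form_sub_smul, form_vec]
          have := mul_nonneg (Nat.cast_nonneg (α := ℝ) x) (o.pos N).le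
          push_cast
          linarith
        have hxB := o.left_block_le hθ0 (by linarith) hlow hN ht hdet' (by omega) (x := x)
          (by rw [← hww]; exact hle)
        have hIH := ih _ (by omega) hN hdet' (by omega) hle' ht rfl
        have hstep := log_two_step (m := w'.1) (n := w.1) (by omega) (by
          have : 1 ≤ (x : ℤ) := by rw [← hx]; exact Int.le_ediv_of_mul_le (by omega) (by omega)
          nlinarith)
        have hH : o.height N w = o.height N w' + x := by
          conv_lhs => rw [hww]
          rw [height_add_smul]
        rw [hH]
        push_cast
        rw [abs_le] at hIH ⊢
        have hx0 : (0 : ℝ) ≤ x := Nat.cast_nonneg x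
        have := mul_le_mul_of_nonneg_left hstep (by linarith : 0 ≤ B)
        constructor <;> linarith

/-- The centred and symmetrized sum of the indices. -/
noncomputable def sum (n : ℕ) : ℝ :=
  ∑ i ∈ Finset.Icc 1 n, (((o.κ i : ℝ) + o.κ (i - 1)) / 2 - 3)

/-- Symmetrizing the index changes the partial sums only by a telescoping boundary term. -/
theorem sum_eq (n : ℕ) :
    o.sum n = ((∑ i ∈ Finset.Icc 1 n, (o.κ i - 3) : ℤ) : ℝ) + ((o.κ 0 : ℝ) - o.κ n) / 2 := by
  induction n with
  | zero => simp [sum]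
  | succ n ih =>
    rw [sum, Finset.sum_Icc_succ_top (by omega), ← sum, ih, Finset.sum_Icc_succ_top (by omega)]
    push_cast
    ring

theorem κ_nonneg (n : ℕ) : 0 ≤ (o.κ (n + 1) : ℝ) := by
  have h := o.add_eq n
  have h1 := o.pos n
  have h2 := o.pos (n + 1)
  have h3 := o.pos (n + 2)
  by_contra hneg
  nlinarith

theorem κ_le (n : ℕ) : (o.κ (n + 1) : ℝ) ≤ 2 / o.α (n + 1) := by
  rw [le_div_iff₀ (o.pos _), ← o.add_eq n]
  linarith [o.le_one n, o.le_one (n + 2)]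

theorem le_κ (n : ℕ) : 2 / o.α (n + 1) - 2 ≤ o.κ (n + 1) := by
  have h1 := o.one_lt n
  have h2 : 1 < o.α (n + 1) + o.α (n + 2) := o.one_lt (n + 1)
  have h3 := o.pos (n + 1)
  rw [sub_le_iff_le_add, div_le_iff₀ h3, add_mul, ← o.add_eq n]
  linarith

theorem exists_abs_sum_le {C θ : ℝ} (hθ0 : 0 ≤ θ) (hθ1 : θ ≤ 1) (hC : 1 ≤ C)
    (hlow : o.LowerBound C θ) (hupp : o.UpperBound C θ)
    (hirr : ∀ w : ℤ × ℤ, 1 ≤ w.1 → o.form w ≠ 0) :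
    ∃ K : ℝ, ∀ n : ℕ, 1 ≤ n → |o.sum n| ≤ K * (n : ℝ) ^ θ * (1 + Real.log n) := by
  obtain ⟨D, hD, hslope⟩ := o.exists_slope_le
  have hb : 0 < o.α 1 / o.α 0 := div_pos (o.pos 1) (o.pos 0)
  set A := 8 * C * D + o.α 1 / o.α 0 + 1 with hA
  have hCD : 0 < C * D := by positivity
  have hA0 : 0 < A := by linarith
  have hlog2 : 0 < Real.log 2 := Real.log_pos (by norm_num)
  set E := 2 * (Real.log (4 * D)) / Real.log 2 with hE
  have hlogD : 0 < Real.log (4 * D) := Real.log_pos (by linarith)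
  have hE0 : 0 < E := by positivity
  refine ⟨A * (4 + E + 2 / Real.log 2) + 4 + |(o.κ 0 : ℝ)|, fun n hn => ?_⟩
  have hn1 : (1 : ℝ) ≤ n := by exact_mod_cast hn
  have hDn : 1 ≤ D * n := by nlinarith
  have hnθ : 1 ≤ (n : ℝ) ^ θ := Real.one_le_rpow hn1 hθ0
  have hDθ : (D * n) ^ θ ≤ D * (n : ℝ) ^ θ := mul_rpow_le hD (by linarith) hθ1
  have hlogn : 0 ≤ Real.log n := Real.log_nonneg hn1
  have h8 : 8 * C * (D * n : ℝ) ^ θ ≤ 8 * C * D * (n : ℝ) ^ θ := by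
    have := mul_le_mul_of_nonneg_left hDθ (by linarith : 0 ≤ 8 * C)
    linarith
  have hH := o.abs_height_le hθ0 hθ1 hC hlow hupp hirr hDn (B := A * (n : ℝ) ^ θ)
    (by nlinarith) (by nlinarith) (by nlinarith) hn (o.det_vec_succ n)
    (o.vec_fst_nonneg _) (o.form_vec_le _) (hslope n hn)
  rw [height_succ] at hH
  have hlogv : ∀ m : ℕ, 1 ≤ m → m ≤ n + 1 →
      ((Nat.log 2 ((o.vec m).1.toNat + 1) : ℕ) : ℝ) ≤ E / 2 + Real.log n / Real.log 2 := by
    intro m hm hmn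
    have hQ := o.vec_fst_pos hm
    have h1 : ((o.vec m).1 : ℝ) ≤ D * m := by
      have h2 := hslope m hm
      rw [slope, div_le_iff₀ (o.pos m)] at h2
      have h3 : 0 ≤ D * m := by positivity
      nlinarith [o.le_one m]
    have h2 : (((o.vec m).1.toNat + 1 : ℕ) : ℝ) ≤ 4 * D * n := by
      have h3 : (((o.vec m).1.toNat : ℕ) : ℝ) = (o.vec m).1 := by
        have : (((o.vec m).1.toNat : ℕ) : ℤ) = (o.vec m).1 := Int.toNat_of_nonneg (by omega)
        exact_mod_cast this
      push_cast
      rw [h3]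
      have h4 : (m : ℝ) ≤ n + 1 := by exact_mod_cast hmn
      nlinarith
    have h3 : ((Nat.log 2 ((o.vec m).1.toNat + 1) : ℕ) : ℝ) * Real.log 2 ≤
        Real.log (4 * D * n) := by
      rw [← Real.log_pow]
      refine Real.log_le_log (by positivity) (le_trans ?_ h2)
      exact_mod_cast Nat.pow_log_le_self 2 (by omega)
    rw [Real.log_mul (by positivity) (by positivity)] at h3
    have h4 : E / 2 + Real.log n / Real.log 2 =
        (Real.log (4 * D) + Real.log n) / Real.log 2 := by
      rw [hE]; field_simp
    rw [h4, le_div_iff₀ hlog2]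
    exact h3
  have hl1 := hlogv n hn (by omega)
  have hl2 := hlogv (n + 1) (by omega) le_rfl
  -- The boundary index is of order `1 / α n`, hence controlled by `LowerBound` at `vec n`.
  have hκ : (o.κ n : ℝ) ≤ 2 * (C * (D * (n : ℝ) ^ θ)) := by
    obtain ⟨m, rfl⟩ := Nat.exists_eq_succ_of_ne_zero (by omega : n ≠ 0)
    refine (o.κ_le m).trans ?_
    have h4 := hlow _ _ (o.det_vec_succ (m + 1)) (o.vec_fst_pos hn) (o.form_vec_pos _)
      (o.form_vec_le _)
    rw [form_vec, ← slope] at h4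
    have h5 := Real.rpow_le_rpow (o.slope_nonneg _) (hslope _ hn) hθ0
    have h6 := mul_le_mul_of_nonneg_left (h5.trans hDθ) (by linarith : 0 ≤ C)
    rw [← mul_one_div]
    linarith
  have hκ0 : 0 ≤ (o.κ n : ℝ) := by
    obtain ⟨m, rfl⟩ := Nat.exists_eq_succ_of_ne_zero (by omega : n ≠ 0)
    exact o.κ_nonneg m
  have hmain : |o.sum n| ≤ A * (n : ℝ) ^ θ * (3 + E + 2 / Real.log 2 * Real.log n) + 3 +
      |(o.κ 0 : ℝ)| + C * (D * (n : ℝ) ^ θ) := by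
    have h1 : A * (n : ℝ) ^ θ * (3 + (Nat.log 2 ((o.vec n).1.toNat + 1) : ℕ) +
        (Nat.log 2 ((o.vec (n + 1)).1.toNat + 1) : ℕ)) ≤
        A * (n : ℝ) ^ θ * (3 + E + 2 / Real.log 2 * Real.log n) := by
      have : 2 / Real.log 2 * Real.log n = 2 * (Real.log n / Real.log 2) := by ring
      exact mul_le_mul_of_nonneg_left (by linarith) (by positivity)
    have h2 := hH.trans h1
    rw [sum_eq]
    have h3 := le_abs_self (o.κ 0 : ℝ)
    have h4 := neg_abs_le (o.κ 0 : ℝ)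
    have h5 := abs_nonneg (o.κ 0 : ℝ)
    rw [abs_le] at h2 ⊢
    constructor <;> linarith
  refine hmain.trans ?_
  have h2 : 0 ≤ |(o.κ 0 : ℝ)| := abs_nonneg _
  have h3 : C * (D * (n : ℝ) ^ θ) ≤ A * (n : ℝ) ^ θ := by
    rw [← mul_assoc]
    gcongr
    linarith
  have h4 : 0 ≤ 2 / Real.log 2 := by positivity
  generalize (n : ℝ) ^ θ = Y at *
  generalize Real.log n = l at *
  generalize 2 / Real.log 2 = F at *
  have hY : 1 ≤ Y * (1 + l) := by nlinarith
  have h5 : (3 + |(o.κ 0 : ℝ)|) ≤ (4 + |(o.κ 0 : ℝ)|) * (Y * (1 + l)) :=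
    (by linarith : (3 + |(o.κ 0 : ℝ)|) ≤ 4 + |(o.κ 0 : ℝ)|).trans
      (le_mul_of_one_le_right (by linarith) hY)
  have e1 : 0 ≤ A * (Y * l) * (4 + E) := by positivity
  have e2 : 0 ≤ A * Y * F := by positivity
  calc A * Y * (3 + E + F * l) + 3 + |(o.κ 0 : ℝ)| + C * (D * Y)
      ≤ A * Y * (3 + E + F * l) + A * Y + (4 + |(o.κ 0 : ℝ)|) * (Y * (1 + l)) := by linarith
    _ ≤ (A * (4 + E + F) + 4 + |(o.κ 0 : ℝ)|) * Y * (1 + l) := by linarith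

end Orbit
-- Lower bounds from good one-sided approximations
/-- The sequence `f` exceeds a multiple of `n ^ θ` along a subsequence on which it is unbounded. -/
def GrowsAtLeast (f : ℕ → ℝ) (θ : ℝ) : Prop :=
  ∃ c : ℝ, 0 < c ∧ ∀ K : ℝ, ∃ n : ℕ, 1 ≤ n ∧ K ≤ |f n| ∧ c * (n : ℝ) ^ θ ≤ |f n|

theorem growsAtLeast_of_sub {f : ℕ → ℝ} {θ : ℝ} (hθ : 0 ≤ θ) {c : ℝ} (hc : 0 < c)
    (h : ∀ K : ℝ, ∃ (n m : ℕ) (B : ℝ), (n : ℝ) ≤ B ∧ (m : ℝ) ≤ B ∧ K ≤ |f n - f m| ∧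
      c * B ^ θ ≤ |f n - f m|) : GrowsAtLeast f θ := by
  refine ⟨c / 2, by positivity, fun K => ?_⟩
  -- One of `|f n|`, `|f m|` is at least half of the difference; the term `|f 0|` ensures that its
  -- index is not 0.
  obtain ⟨n, m, B, hn, hm, hK, hB⟩ := h (2 * (|K| + |f 0| + 1))
  have key : ∀ n : ℕ, (n : ℝ) ≤ B → |f n - f m| ≤ 2 * |f n| ∨ |f n - f m| ≤ 2 * |f m| := by
    intro n _
    have := abs_sub (f n) (f m)
    rcases le_total |f n| |f m| with h1 | h1
    · right; linarith
    · left; linarith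
  have main : ∀ i : ℕ, (i : ℝ) ≤ B → |f n - f m| ≤ 2 * |f i| →
      1 ≤ i ∧ K ≤ |f i| ∧ c / 2 * (i : ℝ) ^ θ ≤ |f i| := by
    intro i hi hle
    have h0 := abs_nonneg (f 0)
    have hKK := le_abs_self K
    have hK0 := abs_nonneg K
    refine ⟨?_, by linarith, ?_⟩
    · rcases Nat.eq_zero_or_pos i with rfl | h
      · linarith
      · exact h
    · have : (i : ℝ) ^ θ ≤ B ^ θ := Real.rpow_le_rpow (Nat.cast_nonneg i) hi hθ
      have := mul_le_mul_of_nonneg_left this hc.le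
      linarith
  rcases key n hn with h1 | h1
  · exact ⟨n, main n hn h1⟩
  · exact ⟨m, main m hm h1⟩

/-- If `d` is comparable with `Q ^ (1 - v)`, then the time `Q / d` has order `Q ^ v` and the jump `1
/ d` is its power `(v - 1) / v`. The primed version treats `1 / (Q d)`, with exponent `(v - 2) / v`.
-/
theorem rpow_div_eq {Q d v : ℝ} (hQ : 0 < Q) (hd : 0 < d) (hv : 0 < v) :
    (Q / d) ^ ((v - 1) / v) = (d * Q ^ (v - 1)) ^ (1 / v) / d := by
  have h1 : (v - 1) / v = 1 - 1 / v := by field_simp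
  have h2 : (d * Q ^ (v - 1)) ^ (1 / v) = d ^ (1 / v) * Q ^ ((v - 1) / v) := by
    rw [Real.mul_rpow hd.le (by positivity), ← Real.rpow_mul hQ.le, mul_one_div]
  have h3 : d ^ ((v - 1) / v) * d ^ (1 / v) = d := by
    rw [← Real.rpow_add hd, h1]; simp
  have h4 : 0 < d ^ ((v - 1) / v) := by positivity
  rw [h2, Real.div_rpow hQ.le hd.le, div_eq_div_iff h4.ne' hd.ne']
  conv_lhs => rw [← h3]
  ring

theorem rpow_div_eq' {Q d v : ℝ} (hQ : 0 < Q) (hd : 0 < d) (hv : 0 < v) :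
    (Q / d) ^ ((v - 2) / v) = (d * Q ^ (v - 1)) ^ (2 / v) / (Q * d) := by
  have h1 : (v - 2) / v = (v - 1) / v + (v - 1) / v - 1 := by field_simp; ring
  have h2 : 2 / v = 1 / v + 1 / v := by ring
  rw [h1, Real.rpow_sub_one (by positivity), Real.rpow_add (by positivity), rpow_div_eq hQ hd hv,
    h2, Real.rpow_add (by positivity)]
  field_simp

theorem mul_rpow_sub_one_le_iff {Q d A v : ℝ} (hQ : 0 < Q) :
    d * Q ^ (v - 1) ≤ A ↔ d ≤ A * Q ^ (1 - v) := by
  rw [← neg_sub v 1, Real.rpow_neg hQ.le, ← div_eq_mul_inv, le_div_iff₀ (by positivity)]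

theorem le_mul_rpow_sub_one_iff {Q d A v : ℝ} (hQ : 0 < Q) :
    A ≤ d * Q ^ (v - 1) ↔ A * Q ^ (1 - v) ≤ d := by
  rw [← neg_sub v 1, Real.rpow_neg hQ.le, ← div_eq_mul_inv, div_le_iff₀ (by positivity)]

theorem rpow_div_le {Q d A v : ℝ} (hQ : 0 < Q) (hd : 0 < d) (hv : 0 < v)
    (h : d ≤ A * Q ^ (1 - v)) : (Q / d) ^ ((v - 1) / v) ≤ A ^ (1 / v) / d := by
  rw [rpow_div_eq hQ hd hv]
  rw [← mul_rpow_sub_one_le_iff hQ] at h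
  gcongr

theorem rpow_div_le' {Q d A v : ℝ} (hQ : 0 < Q) (hd : 0 < d) (hv : 0 < v)
    (h : d ≤ A * Q ^ (1 - v)) : (Q / d) ^ ((v - 2) / v) ≤ A ^ (2 / v) / (Q * d) := by
  rw [rpow_div_eq' hQ hd hv]
  rw [← mul_rpow_sub_one_le_iff hQ] at h
  gcongr

theorem le_rpow_div {Q d A v : ℝ} (hQ : 0 < Q) (hd : 0 < d) (hA : 0 < A) (hv : 0 < v)
    (h : A * Q ^ (1 - v) ≤ d) : A ^ (1 / v) / d ≤ (Q / d) ^ ((v - 1) / v) := by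
  rw [rpow_div_eq hQ hd hv]
  rw [← le_mul_rpow_sub_one_iff hQ] at h
  gcongr

theorem le_rpow_div' {Q d A v : ℝ} (hQ : 0 < Q) (hd : 0 < d) (hA : 0 < A) (hv : 0 < v)
    (h : A * Q ^ (1 - v) ≤ d) : A ^ (2 / v) / (Q * d) ≤ (Q / d) ^ ((v - 2) / v) := by
  rw [rpow_div_eq' hQ hd hv]
  rw [← le_mul_rpow_sub_one_iff hQ] at h
  gcongr

namespace Orbit

variable (o : Orbit)

theorem index_le {N : ℕ} : (N : ℝ) ≤ (o.vec N).1 / o.α N / o.α 0 := by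
  rw [le_div_iff₀ (o.pos 0), mul_comm]
  exact o.le_slope N

/-- A jump of the sums at a good approximation from below. -/
theorem exists_sub_ge_of_form_pos {u w : ℤ × ℤ} (h : det u w = 1) (hu : 1 ≤ u.1)
    (hpos : 0 < o.form u) (hle : o.form u ≤ 1) :
    ∃ n m : ℕ, (n : ℝ) ≤ u.1 / o.form u / o.α 0 ∧ (m : ℝ) ≤ u.1 / o.form u / o.α 0 ∧
      1 / o.form u - 4 - |(o.κ 0 : ℝ)| ≤ |o.sum n - o.sum m| := by
  obtain ⟨N, rfl⟩ := o.exists_vec_eq h (by omega) hpos hle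
  have hN : N ≠ 0 := by
    rintro rfl
    simp [vec] at hu
  obtain ⟨m, rfl⟩ := Nat.exists_eq_succ_of_ne_zero hN
  rw [form_vec]
  have hidx := o.index_le (N := m + 1)
  refine ⟨m + 1, m, hidx, le_trans (by push_cast; linarith) hidx, ?_⟩
  refine le_trans ?_ (le_abs_self _)
  -- A single term suffices: its index is at least `2 / α (m + 1) - 2`.
  have h1 : o.sum (m + 1) - o.sum m = ((o.κ (m + 1) : ℝ) + o.κ m) / 2 - 3 := by
    rw [sum, Finset.sum_Icc_succ_top (by omega), ← sum]
    simp
  have h2 := o.le_κ m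
  have h3 : -|(o.κ 0 : ℝ)| ≤ o.κ m := by
    rcases m with _ | m
    · exact neg_abs_le _
    · exact (neg_nonpos.2 (abs_nonneg _)).trans (o.κ_nonneg m)
  have h4 := abs_nonneg (o.κ 0 : ℝ)
  rw [h1]
  have h5 : 2 / o.α (m + 1) = 2 * (1 / o.α (m + 1)) := by ring
  rw [h5] at h2
  simp only [Nat.succ_eq_add_one]
  linarith

/-- The determinant in the height may be large, but it is within `3/2` of half the index at `n`,
which is what the symmetrized sum subtracts. This holds because the coordinates on either side of `α
n` both lie in `(1 - α n, 1]`, and `-form w ≤ α n`. -/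
theorem sum_eq_height (n : ℕ) {w : ℤ × ℤ} (h : det (o.vec n) w = 1) (hn : 1 ≤ n)
    (hneg : o.form w ≤ 0) (hl : -o.form w ≤ o.α n) :
    |o.sum n - (o.height n w + (o.κ 0 : ℝ) / 2)| ≤ 3 / 2 := by
  obtain ⟨m, rfl⟩ := Nat.exists_eq_succ_of_ne_zero (by omega : n ≠ 0)
  simp only [Nat.succ_eq_add_one] at *
  have hy := congrArg o.form (eq_combination h (o.vec (m + 1 + 1)))
  rw [det_vec_succ, one_smul, form_add, form_smul, form_vec, form_vec] at hy
  have hH : o.height (m + 1) w =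
      ∑ i ∈ Finset.Icc 1 (m + 1), (o.κ i - 3) - det (o.vec (m + 1 + 1)) w := rfl
  have hS : ((∑ i ∈ Finset.Icc 1 (m + 1), (o.κ i - 3) : ℤ) : ℝ) =
      o.height (m + 1) w + (det (o.vec (m + 1 + 1)) w : ℤ) := by
    rw [hH]; push_cast; ring
  rw [sum_eq, hS]
  have e : m + 1 + 1 = m + 2 := rfl
  rw [e] at *
  generalize det (o.vec (m + 2)) w = y at *
  have hadd := o.add_eq m
  have h1 := o.one_lt m
  have h2 : 1 < o.α (m + 1) + o.α (m + 2) := o.one_lt (m + 1)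
  have h3 := o.le_one m
  have h4 := o.le_one (m + 2)
  have hp := o.pos (m + 1)
  have h5 : ((y : ℝ) - o.κ (m + 1) / 2) * o.α (m + 1) =
      -o.form w + (o.α (m + 2) - o.α m) / 2 := by linarith
  have h6 : |(y : ℝ) - o.κ (m + 1) / 2| ≤ 3 / 2 := by
    rw [abs_le]
    constructor
    · by_contra hc
      nlinarith
    · by_contra hc
      nlinarith
  convert h6 using 2
  ring

/-- A drop of the sums near a good approximation from above. -/
theorem exists_sub_ge_of_form_neg {z w : ℤ × ℤ} (h : det z w = 1) (hw : 2 ≤ w.1)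
    (hneg : o.form w < 0) {X : ℕ} (hX1 : 1 ≤ X)
    (hX : X * (w.1 * -o.form w) ≤ o.α 0 / 4) :
    ∃ n m : ℕ, (n : ℝ) ≤ 4 * w.1 ^ 2 * (X + 1) / o.α 0 ^ 2 ∧
      (m : ℝ) ≤ 4 * w.1 ^ 2 * (X + 1) / o.α 0 ^ 2 ∧ (X : ℝ) - 3 ≤ |o.sum n - o.sum m| := by
  set l := -o.form w with hl
  have hl0 : 0 < l := by linarith
  have hX1' : (1 : ℝ) ≤ X := by exact_mod_cast hX1
  have hq : (2 : ℝ) ≤ w.1 := by exact_mod_cast hw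
  have ha := o.pos 0
  have ha1 := o.le_one 0
  -- Reducing modulo `w` gives an early left neighbour, with form about `α 0 / w.1`; the hypothesis
  -- on `X` keeps the form at least `α 0 / (4 w.1)` along the whole chain `u + y w`, `y ≤ X`.
  obtain ⟨u, hu⟩ : ∃ u, u = z - (z.1 / w.1) • w := ⟨_, rfl⟩
  have hdet : det u w = 1 := by
    rw [hu, sub_eq_add_neg, ← neg_smul, det_add_left, det_smul_left, det_self, h]; ring
  have hu1 : u.1 = z.1 % w.1 := by
    have := Int.emod_add_mul_ediv z.1 w.1
    rw [hu]
    simp only [Prod.fst_sub, Prod.smul_fst, smul_eq_mul]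
    linarith
  have hm0 := Int.emod_nonneg z.1 (by omega : w.1 ≠ 0)
  have hm1 := Int.emod_lt_of_pos z.1 (by omega : 0 < w.1)
  rw [← hu1] at hm0 hm1
  have hm0' : (0 : ℝ) ≤ u.1 := by exact_mod_cast hm0
  have hm1' : (u.1 : ℝ) ≤ w.1 := by exact_mod_cast hm1.le
  have hd := o.form_det u w
  have hfw : o.form w = -l := by linarith
  rw [hdet, hfw] at hd
  push_cast at hd
  have hwl : 0 < w.1 * l := by positivity
  have hql : w.1 * l ≤ o.α 0 / 4 := by
    have := le_mul_of_one_le_left hwl.le hX1'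
    linarith
  have hupper : w.1 * o.form u ≤ o.α 0 := by nlinarith
  have hlower : o.α 0 / 2 ≤ w.1 * o.form u := by nlinarith
  have hform : ∀ y : ℝ, 0 ≤ y → y ≤ X →
      o.α 0 / 4 ≤ w.1 * (o.form u + y * o.form w) ∧ o.form u + y * o.form w ≤ 1 := by
    intro y hy0 hyX
    rw [hfw]
    have h1 : y * (w.1 * l) ≤ X * (w.1 * l) := by gcongr
    have h2 : 0 ≤ y * l := by positivity
    constructor
    · linarith
    · nlinarith
  have hposf : ∀ y : ℝ, 0 ≤ y → y ≤ X → 0 < o.form u + y * o.form w := by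
    intro y hy0 hyX
    have h1 := (hform y hy0 hyX).1
    exact pos_of_mul_pos_right (lt_of_lt_of_le (by linarith) h1) (by linarith)
  have hfu := hposf 0 le_rfl (by linarith)
  have hfu1 := (hform 0 le_rfl (by linarith)).2
  rw [zero_mul, add_zero] at hfu hfu1
  obtain ⟨N, hN⟩ := o.exists_vec_eq hdet hm0 hfu hfu1
  obtain ⟨M, hM, hH⟩ := o.exists_height_eq_sub (N := N) (w := w) (by rw [hN, hdet]) (by omega) X
    (by
      intro y hy
      rw [hN, form_add, form_smul]
      push_cast
      exact ⟨hposf y (Nat.cast_nonneg y) (by exact_mod_cast hy),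
        (hform y (Nat.cast_nonneg y) (by exact_mod_cast hy)).2⟩)
  rw [hN] at hM
  have hMw : det (o.vec M) w = 1 := by
    rw [hM, det_add_left, hdet, det_smul_left, det_self]; ring
  have hαM : o.α M = o.form u + X * o.form w := by
    rw [← form_vec, hM, form_add, form_smul]; push_cast; ring
  have hαN : o.α N = o.form u := by rw [← form_vec, hN]
  have hMX := (hform X (by linarith) le_rfl).1
  rw [← hαM] at hMX
  have hne : ∀ n, det (o.vec n) w = 1 → 1 ≤ n := by
    intro n hn
    rcases Nat.eq_zero_or_pos n with rfl | h
    · simp [vec, det] at hn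
      omega
    · exact h
  have hNM : N ≤ M := by
    by_contra hlt
    have h1 := (o.det_vec_pos_iff M N).2 (by omega)
    rw [hM, hN, det_add_left, det_smul_left, det_self, det_comm, hdet] at h1
    omega
  have hMB : (M : ℝ) ≤ 4 * w.1 ^ 2 * (X + 1) / o.α 0 ^ 2 := by
    refine o.index_le.trans ?_
    have hp := o.pos M
    have hQM : ((o.vec M).1 : ℝ) ≤ w.1 * (X + 1) := by
      rw [hM]
      push_cast [Prod.fst_add, Prod.smul_fst, smul_eq_mul]
      linarith
    have h0 : (0 : ℝ) ≤ w.1 * (X + 1) := by positivity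
    rw [div_div, div_le_div_iff₀ (by positivity) (by positivity)]
    calc ((o.vec M).1 : ℝ) * o.α 0 ^ 2 ≤ w.1 * (X + 1) * o.α 0 ^ 2 := by gcongr
      _ = w.1 * (X + 1) * o.α 0 * (4 * (o.α 0 / 4)) := by ring
      _ ≤ w.1 * (X + 1) * o.α 0 * (4 * (w.1 * o.α M)) := by gcongr
      _ = 4 * w.1 ^ 2 * (X + 1) * (o.α M * o.α 0) := by ring
  have hNM' : (N : ℝ) ≤ M := by exact_mod_cast hNM
  refine ⟨N, M, hNM'.trans hMB, hMB, ?_⟩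
  have hlM : l ≤ o.α M := le_of_mul_le_mul_left (hql.trans hMX) (by linarith)
  have hlN : l ≤ o.α N := by
    rw [hαM, hfw] at hlM
    rw [hαN]
    nlinarith
  have h1 := o.sum_eq_height N (by rw [hN, hdet]) (hne N (by rw [hN, hdet])) hneg.le hlN
  have h2 := o.sum_eq_height M hMw (hne M hMw) hneg.le hlM
  rw [hH] at h2
  push_cast at h2
  rw [abs_le] at h1 h2
  refine le_trans ?_ (le_abs_self _)
  linarith

theorem growsAtLeast_of_form_pos {A v : ℝ} (hA : 0 < A) (hv : 1 < v)
    (h : ∀ ε : ℝ, 0 < ε → ∃ u w : ℤ × ℤ, det u w = 1 ∧ 1 ≤ u.1 ∧ 0 < o.form u ∧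
      o.form u < ε ∧ o.form u ≤ A * (u.1 : ℝ) ^ (1 - v)) :
    GrowsAtLeast o.sum ((v - 1) / v) := by
  have ha := o.pos 0
  have hθ : 0 ≤ (v - 1) / v := div_nonneg (by linarith) (by linarith)
  have hD : 0 < A ^ (1 / v) * (1 / o.α 0) ^ ((v - 1) / v) := by positivity
  refine growsAtLeast_of_sub hθ (c := 1 / 2 / (A ^ (1 / v) * (1 / o.α 0) ^ ((v - 1) / v)))
    (by positivity) fun K => ?_
  set R := 2 * (|K| + 4 + |(o.κ 0 : ℝ)|) with hR
  have hR0 : 8 ≤ R := by linarith [abs_nonneg K, abs_nonneg (o.κ 0 : ℝ)]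
  obtain ⟨u, w, hdet, hu, hpos, hlt, hle⟩ := h (1 / R) (by positivity)
  have h1R : 1 / R ≤ 1 := by rw [div_le_one (by linarith)]; linarith
  obtain ⟨n, m, hn, hm, hnm⟩ := o.exists_sub_ge_of_form_pos hdet hu hpos (by linarith)
  have hR1 : R ≤ 1 / o.form u := by
    rw [le_div_iff₀ hpos]
    rw [lt_div_iff₀ (by linarith)] at hlt
    linarith
  have hQ : (0 : ℝ) < u.1 := by exact_mod_cast (by omega : 0 < u.1)
  have hKa := le_abs_self K
  have hK0 := abs_nonneg K
  have hκ0 := abs_nonneg (o.κ 0 : ℝ)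
  refine ⟨n, m, u.1 / o.form u / o.α 0, hn, hm, by linarith, ?_⟩
  have h1 := rpow_div_le hQ hpos (by linarith) hle
  have h2 : (u.1 / o.form u / o.α 0) ^ ((v - 1) / v) =
      (u.1 / o.form u) ^ ((v - 1) / v) * (1 / o.α 0) ^ ((v - 1) / v) := by
    rw [← Real.mul_rpow (by positivity) (by positivity), mul_one_div]
  rw [h2]
  calc _ ≤ 1 / 2 / (A ^ (1 / v) * (1 / o.α 0) ^ ((v - 1) / v)) *
        (A ^ (1 / v) / o.form u * (1 / o.α 0) ^ ((v - 1) / v)) := by gcongr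
    _ = 1 / o.form u / 2 := by field_simp
    _ ≤ _ := by linarith

theorem growsAtLeast_of_form_neg {A v : ℝ} (hA : 0 < A) (hv : 2 < v)
    (h : ∀ ε : ℝ, 0 < ε → ∃ z w : ℤ × ℤ, det z w = 1 ∧ 2 ≤ w.1 ∧ o.form w < 0 ∧
      w.1 * -o.form w < ε ∧ -o.form w ≤ A * (w.1 : ℝ) ^ (1 - v)) :
    GrowsAtLeast o.sum ((v - 2) / v) := by
  have ha := o.pos 0
  have hθ : 0 ≤ (v - 2) / v := div_nonneg (by linarith) (by linarith)
  set θ := (v - 2) / v with hθdef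
  have hD : 0 < A ^ (2 / v) * (2 / o.α 0) ^ θ := by positivity
  refine growsAtLeast_of_sub hθ (c := o.α 0 / 16 / (A ^ (2 / v) * (2 / o.α 0) ^ θ))
    (by positivity) fun K => ?_
  set R := |K| + 6 with hR
  have hK0 := abs_nonneg K
  obtain ⟨z, w, hdet, hw, hneg, hlt, hle⟩ := h (o.α 0 / 4 / (R + 1)) (by positivity)
  set l := -o.form w with hl
  have hl0 : 0 < l := by linarith
  have hQ : (0 : ℝ) < w.1 := by exact_mod_cast (by omega : 0 < w.1)
  -- Its integer part is the longest chain that `exists_sub_ge_of_form_neg` allows.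
  set Y := o.α 0 / 4 / (w.1 * l) with hY
  have hYR : R + 1 < Y := by
    rw [hY, lt_div_iff₀ (by positivity)]
    rw [lt_div_iff₀ (by linarith)] at hlt
    linarith
  have hXY : (⌊Y⌋₊ : ℝ) ≤ Y := Nat.floor_le (by linarith)
  have hYX : Y < ⌊Y⌋₊ + 1 := Nat.lt_floor_add_one Y
  set X := ⌊Y⌋₊ with hX
  have hX1 : 1 ≤ X := by
    have : (1 : ℝ) ≤ X := by linarith
    exact_mod_cast this
  obtain ⟨n, m, hn, hm, hnm⟩ := o.exists_sub_ge_of_form_neg hdet hw hneg hX1 (by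
    rw [hY, le_div_iff₀ (by positivity)] at hXY
    exact hXY)
  refine ⟨n, m, _, hn, hm, by linarith [le_abs_self K], ?_⟩
  have hB : 4 * (w.1 : ℝ) ^ 2 * (X + 1) / o.α 0 ^ 2 ≤ w.1 / l * (2 / o.α 0) := by
    calc 4 * (w.1 : ℝ) ^ 2 * (X + 1) / o.α 0 ^ 2 ≤ 4 * (w.1 : ℝ) ^ 2 * (2 * Y) / o.α 0 ^ 2 := by
          gcongr; linarith
      _ = w.1 / l * (2 / o.α 0) := by rw [hY]; field_simp
  have h1 := rpow_div_le' hQ hl0 (by linarith) hle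
  rw [← hθdef] at h1
  have h2 := Real.rpow_le_rpow (by positivity) hB hθ
  rw [Real.mul_rpow (by positivity) (by positivity)] at h2
  calc _ ≤ o.α 0 / 16 / (A ^ (2 / v) * (2 / o.α 0) ^ θ) *
        (A ^ (2 / v) / (w.1 * l) * (2 / o.α 0) ^ θ) := by
        refine mul_le_mul_of_nonneg_left (h2.trans ?_) (by positivity)
        gcongr
    _ = Y / 4 := by rw [hY]; field_simp; ring
    _ ≤ _ := by linarith

end Orbit
-- One-sided Diophantine exponents
/-- The rational numbers that approximate `s` from below with exponent `v`. -/
def oddSet (s v : ℝ) : Set ℚ := {r : ℚ | 0 < s - (r : ℝ) ∧ s - (r : ℝ) < 1 / (r.den : ℝ) ^ v}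

theorem oddSet_anti {s v v' : ℝ} (h : v ≤ v') : oddSet s v' ⊆ oddSet s v := by
  rintro r ⟨h1, h2⟩
  refine ⟨h1, h2.trans_le ?_⟩
  have hd : (1 : ℝ) ≤ r.den := by exact_mod_cast r.den_pos
  have := Real.rpow_le_rpow_of_exponent_le hd h
  gcongr

theorem evenExp_eq_oddExp_neg (s : ℝ) : evenExp s = oddExp (-s) := by
  unfold evenExp oddExp
  congr 1
  ext v
  refine exists_congr fun w => and_congr_right fun _ => ?_
  have h : {r : ℚ | 0 < -s - (r : ℝ) ∧ -s - (r : ℝ) < 1 / (r.den : ℝ) ^ w} =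
      (fun r : ℚ => -r) ⁻¹' {r : ℚ | 0 < (r : ℝ) - s ∧ (r : ℝ) - s < 1 / (r.den : ℝ) ^ w} := by
    ext r
    simp only [Set.mem_ofPred_eq, Set.mem_preimage, Rat.cast_neg, Rat.den_neg_eq_den]
    rw [show -(r : ℝ) - s = -s - r by ring]
  rw [h]
  refine ⟨fun hi => ?_, fun hi => ?_⟩
  · exact hi.preimage (by intro r _; exact ⟨-r, by simp⟩)
  · intro hf
    exact hi (hf.preimage (neg_injective.injOn))

theorem oddSet_infinite_of_lt {s v : ℝ} (h : (v : EReal) < oddExp s) : (oddSet s v).Infinite := by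
  obtain ⟨_, ⟨w, rfl, hw⟩, hlt⟩ := lt_sSup_iff.1 h
  exact Set.Infinite.mono (oddSet_anti (EReal.coe_le_coe_iff.1 hlt.le)) hw

theorem oddSet_finite_of_lt {s v : ℝ} (h : oddExp s < (v : EReal)) : (oddSet s v).Finite := by
  by_contra hi
  exact absurd h (not_lt.2 (le_sSup ⟨v, rfl, hi⟩))

theorem le_oddExp {s v : ℝ} (h : (oddSet s v).Infinite) : (v : EReal) ≤ oddExp s :=
  le_sSup ⟨v, rfl, h⟩

/-- A bounded interval contains only finitely many rationals of bounded denominator. -/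
theorem exists_den_gt {S : Set ℚ} (hS : S.Infinite) {s B : ℝ} (hB : ∀ r ∈ S, |s - (r : ℝ)| ≤ B)
    (D : ℕ) : ∃ r ∈ S, D < r.den := by
  by_contra! hcon
  refine hS ?_
  obtain ⟨M, hM⟩ := exists_nat_gt ((|s| + B) * D)
  refine Set.Finite.of_finite_image (f := fun r : ℚ => (r.num, r.den))
    (((Set.finite_Icc (-(M : ℤ)) M).prod (Set.finite_Icc 0 D)).subset ?_) ?_
  · rintro _ ⟨r, hr, rfl⟩
    have hd : (0 : ℝ) < r.den := by exact_mod_cast r.den_pos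
    have hdD : (r.den : ℝ) ≤ D := by exact_mod_cast hcon r hr
    have hnum : (r.num : ℝ) = r * r.den := by
      have := Rat.mul_den_eq_num r
      exact_mod_cast this.symm
    have habs : |(r : ℝ)| ≤ |s| + B := by
      have h1 := hB r hr
      have h2 := abs_sub_abs_le_abs_sub (r : ℝ) s
      rw [abs_sub_comm] at h2
      linarith
    have h1 : |(r.num : ℝ)| ≤ M := by
      rw [hnum, abs_mul, abs_of_pos hd]
      have := abs_nonneg (r : ℝ)
      calc |(r : ℝ)| * r.den ≤ (|s| + B) * D := by gcongr; exact this.trans habs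
        _ ≤ M := hM.le
    have h2 : |r.num| ≤ (M : ℤ) := by exact_mod_cast h1
    exact ⟨abs_le.1 h2, Nat.zero_le _, hcon r hr⟩
  · intro r _ r' _ h
    simp only [Prod.mk.injEq] at h
    exact Rat.ext h.1 h.2

theorem exists_mem_oddSet_den_gt {s v : ℝ} (hv : 0 ≤ v) (h : (oddSet s v).Infinite) (D : ℕ) :
    ∃ r ∈ oddSet s v, D < r.den := by
  refine exists_den_gt h (s := s) (B := 1) (fun r hr => ?_) D
  rw [abs_of_pos hr.1]
  refine hr.2.le.trans ?_
  have hd : (1 : ℝ) ≤ r.den := by exact_mod_cast r.den_pos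
  exact div_le_one_of_le₀ (Real.one_le_rpow hd hv) (by positivity)

theorem exists_det_eq_one (r : ℚ) : ∃ w : ℤ × ℤ, det ((r.den : ℤ), r.num) w = 1 := by
  have h : IsCoprime (r.den : ℤ) r.num := by
    rw [Int.isCoprime_iff_gcd_eq_one, Int.gcd_comm]
    exact r.reduced
  obtain ⟨a, b, hab⟩ := h
  exact ⟨(-b, a), by simp only [det]; linarith⟩

theorem exists_det_eq_one' (r : ℚ) : ∃ z : ℤ × ℤ, det z ((r.den : ℤ), r.num) = 1 := by
  obtain ⟨w, hw⟩ := exists_det_eq_one r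
  exact ⟨-w, by rw [← hw]; simp [det]; ring⟩

theorem exists_rat_of_det {u w : ℤ × ℤ} (h : det u w = 1) (hu : 1 ≤ u.1) :
    ∃ r : ℚ, u = ((r.den : ℤ), r.num) := by
  have hc : Nat.Coprime u.2.natAbs u.1.natAbs := by
    rw [← Int.isCoprime_iff_nat_coprime]
    exact ⟨-w.1, w.2, by simp only [det] at h; linarith⟩
  exact ⟨(u.2 : ℚ) / u.1, Prod.ext (Rat.den_div_eq_of_coprime (by omega) hc).symm
    (Rat.num_div_eq_of_coprime (by omega) hc).symm⟩

theorem exists_rat_of_det' {z w : ℤ × ℤ} (h : det z w = 1) (hw : 1 ≤ w.1) :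
    ∃ r : ℚ, w = ((r.den : ℤ), r.num) :=
  exists_rat_of_det (u := w) (w := -z) (by rw [← h]; simp [det]; ring) hw

/-- A good approximation from above yields one from below. -/
theorem exists_mem_oddSet_two {s : ℝ} {r : ℚ} (h0 : 0 < (r : ℝ) - s)
    (h1 : (r : ℝ) - s < 1 / (r.den : ℝ) ^ 2) :
    ∃ r' ∈ oddSet s 2, s - (r' : ℝ) ≤ 1 / r.den := by
  obtain ⟨z, hz⟩ := exists_det_eq_one' r
  have hq : (0 : ℝ) < r.den := by exact_mod_cast r.den_pos
  set d := r.den * ((r : ℝ) - s) with hd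
  have hd0 : 0 < d := by positivity
  have hdq : r.den * d < 1 := by
    rw [lt_div_iff₀ (by positivity)] at h1
    rw [hd]
    linarith
  have hnum : (r.num : ℝ) = r * r.den := by
    have := Rat.mul_den_eq_num r
    exact_mod_cast this.symm
  -- This choice of neighbour puts its linear form in `(0, d]`; unimodularity then forces a positive
  -- denominator and the quadratic bound.
  set k := ⌈(z.1 * s - z.2) / d⌉ - 1 with hk
  have hk1 : (k : ℝ) * d < z.1 * s - z.2 := by
    rw [← lt_div_iff₀ hd0, hk]
    push_cast
    linarith [Int.ceil_lt_add_one ((z.1 * s - z.2) / d)]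
  have hk2 : z.1 * s - z.2 ≤ ((k : ℝ) + 1) * d := by
    rw [← div_le_iff₀ hd0, hk]
    push_cast
    linarith [Int.le_ceil ((z.1 * s - z.2) / d)]
  obtain ⟨u, hu⟩ : ∃ u, u = z + k • ((r.den : ℤ), r.num) := ⟨_, rfl⟩
  have hdet : det u ((r.den : ℤ), r.num) = 1 := by
    rw [hu, det_add_left, det_smul_left, det_self, hz]; ring
  have hL : (u.1 : ℝ) * s - u.2 = z.1 * s - z.2 - k * d := by
    rw [hu, hd]
    simp only [Prod.fst_add, Prod.snd_add, Prod.smul_fst, Prod.smul_snd, smul_eq_mul]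
    push_cast
    rw [hnum]
    ring
  set L := (u.1 : ℝ) * s - u.2 with hLdef
  have hL0 : 0 < L := by linarith
  have hLd : L ≤ d := by linarith
  have hid : r.den * L + u.1 * d = 1 := by
    have : ((det u ((r.den : ℤ), r.num) : ℤ) : ℝ) = 1 := by rw [hdet]; simp
    simp only [det] at this
    push_cast at this
    rw [hnum] at this
    rw [← this, hLdef, hd]
    ring
  have hu1 : 1 ≤ u.1 := by
    have h2 : r.den * L ≤ r.den * d := by gcongr
    have h3 : 0 < (u.1 : ℝ) * d := by linarith
    have h4 : 0 < u.1 := by exact_mod_cast pos_of_mul_pos_left h3 hd0.le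
    omega
  obtain ⟨r', hr'⟩ := exists_rat_of_det hdet hu1
  have hnum' : (r'.num : ℝ) = r' * r'.den := by
    have := Rat.mul_den_eq_num r'
    exact_mod_cast this.symm
  have hq' : (1 : ℝ) ≤ r'.den := by exact_mod_cast r'.den_pos
  rw [hr'] at hid
  simp only [Int.cast_natCast] at hid
  have hLr : L = r'.den * (s - r') := by
    rw [hLdef, hr']
    simp only [Int.cast_natCast]
    rw [hnum']
    ring
  have hs0 : 0 < s - (r' : ℝ) := by
    rw [hLr] at hL0
    exact pos_of_mul_pos_right hL0 (by linarith)
  refine ⟨r', ⟨hs0, ?_⟩, ?_⟩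
  · rw [Real.rpow_two, lt_div_iff₀ (by positivity)]
    have h2 : (r'.den : ℝ) * L ≤ r'.den * d := by gcongr
    have h3 : 0 < r.den * L := by positivity
    rw [hLr] at h2 h3
    nlinarith
  · rw [le_div_iff₀ hq]
    have h2 : s - (r' : ℝ) ≤ L := by
      rw [hLr]
      exact le_mul_of_one_le_left hs0.le hq'
    have h3 : (s - (r' : ℝ)) * r.den ≤ d * r.den := by gcongr; linarith
    linarith

/-- If the set were finite, Dirichlet's theorem would give infinitely many quadratic approximations
from above. Their neighbours from below come within `1 / q` of `s`, closer than the least distance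
in the finite set. -/
theorem oddSet_two_infinite {s : ℝ} (hs : Irrational s) : (oddSet s 2).Infinite := by
  have hinf := Real.infinite_rat_abs_sub_lt_one_div_den_sq_of_irrational hs
  intro hfin
  have hev : {r : ℚ | 0 < (r : ℝ) - s ∧ (r : ℝ) - s < 1 / (r.den : ℝ) ^ 2}.Infinite := by
    intro hfin'
    refine hinf ((hfin.union hfin').subset fun r hr => ?_)
    simp only [Set.mem_ofPred_eq] at hr
    have hne : s - (r : ℝ) ≠ 0 := sub_ne_zero.2 fun h => hs ⟨r, h.symm⟩
    rcases lt_or_gt_of_ne hne with h | h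
    · right
      rw [abs_of_neg h] at hr
      exact ⟨by linarith, by linarith⟩
    · left
      rw [abs_of_pos h] at hr
      exact ⟨h, by rw [Real.rpow_two]; exact hr⟩
  obtain ⟨ε, hε, hmin⟩ : ∃ ε : ℝ, 0 < ε ∧ ∀ r ∈ oddSet s 2, ε ≤ s - (r : ℝ) := by
    rcases (oddSet s 2).eq_empty_or_nonempty with h | h
    · exact ⟨1, one_pos, by simp [h]⟩
    · obtain ⟨r, hr, hmin⟩ := Set.exists_min_image _ (fun r : ℚ => s - (r : ℝ)) hfin h
      exact ⟨_, hr.1, hmin⟩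
  obtain ⟨D, hD⟩ := exists_nat_gt (1 / ε)
  obtain ⟨r, ⟨hr0, hr1⟩, hrD⟩ := exists_den_gt hev (s := s) (B := 1) (fun r hr => by
    rw [abs_sub_comm, abs_of_pos hr.1]
    refine hr.2.le.trans ?_
    have hd : (1 : ℝ) ≤ r.den := by exact_mod_cast r.den_pos
    exact div_le_one_of_le₀ (one_le_pow₀ hd) (by positivity)) D
  obtain ⟨r', hr', hle⟩ := exists_mem_oddSet_two hr0 hr1
  have h1 := hmin r' hr'
  have h2 : (D : ℝ) < r.den := by exact_mod_cast hrD
  have h3 : 1 / (r.den : ℝ) < ε := by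
    rw [div_lt_iff₀ (by linarith [one_div_pos.2 hε])]
    rw [div_lt_iff₀ hε] at hD
    nlinarith
  linarith

theorem two_le_oddExp {s : ℝ} (hs : Irrational s) : 2 ≤ oddExp s :=
  le_oddExp (oddSet_two_infinite hs)

theorem two_le_evenExp {s : ℝ} (hs : Irrational s) : 2 ≤ evenExp s := by
  rw [evenExp_eq_oddExp_neg]
  exact two_le_oddExp hs.neg

/-- Inverting `r` near `s` reverses the side and changes error and denominator by bounded factors.
Lowering the exponent slightly absorbs these for large denominators. -/
theorem oddExp_le_evenExp_inv {s : ℝ} (hs : Irrational s) : oddExp s ≤ evenExp s⁻¹ := by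
  have hs0 : s ≠ 0 := hs.ne_zero
  refine sSup_le ?_
  rintro _ ⟨w, rfl, hw⟩
  rw [← EReal.ge_of_forall_gt_iff_ge]
  intro v hv
  rw [EReal.coe_lt_coe_iff] at hv
  rcases le_or_gt v 2 with hv2 | hv2
  · exact (EReal.coe_le_coe_iff.2 hv2).trans (two_le_evenExp hs.inv)
  refine le_sSup ⟨v, rfl, ?_⟩
  have hsp : 0 < |s| := abs_pos.2 hs0
  set A := 2 / s ^ 2 * (2 * |s|) ^ v with hA
  have hA0 : 0 < A := by
    have : 0 < s ^ 2 := by positivity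
    positivity
  have htend := tendsto_rpow_atTop (sub_pos.2 hv)
  obtain ⟨D, hD⟩ := ((htend.comp tendsto_natCast_atTop_atTop).eventually_gt_atTop A).exists_forall_of_atTop
  obtain ⟨E, hE⟩ := exists_nat_gt (2 / |s|)
  have hinf : (oddSet s w ∩ {r : ℚ | D + E < r.den}).Infinite := by
    intro hfin
    have h2 : (oddSet s w \ {r : ℚ | D + E < r.den}).Infinite := by
      intro h3
      refine hw ((hfin.union h3).subset ?_)
      rw [Set.inter_union_sdiff]
      exact fun _ h => h
    obtain ⟨r, hr, hlt⟩ := exists_den_gt h2 (s := s) (B := 1) (fun r hr => by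
      rw [abs_of_pos hr.1.1]
      refine hr.1.2.le.trans ?_
      have hd : (1 : ℝ) ≤ r.den := by exact_mod_cast r.den_pos
      exact div_le_one_of_le₀ (Real.one_le_rpow hd (by linarith)) (by positivity)) (D + E)
    exact hr.2 hlt
  refine ((hinf.image (f := fun r : ℚ => r⁻¹) inv_injective.injOn).mono ?_)
  rintro _ ⟨r, ⟨⟨h0, h1⟩, hden⟩, rfl⟩
  have hden' : D + E < r.den := hden
  have hq : (1 : ℝ) ≤ r.den := by exact_mod_cast r.den_pos
  have hclose : s - r ≤ |s| / 2 := by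
    have h2 : (r.den : ℝ) ≤ (r.den : ℝ) ^ w := by
      conv_lhs => rw [← Real.rpow_one (r.den : ℝ)]
      exact Real.rpow_le_rpow_of_exponent_le hq (by linarith)
    have h3 : (E : ℝ) ≤ r.den := by exact_mod_cast (by omega : E ≤ r.den)
    refine h1.le.trans ?_
    rw [div_le_div_iff₀ (by linarith) (by norm_num)]
    rw [div_lt_iff₀ hsp] at hE
    nlinarith
  have hrs : s ^ 2 / 2 ≤ r * s := by
    have h2 : (s - r) * s ≤ |s| / 2 * |s| := by
      calc (s - r) * s ≤ (s - r) * |s| := by gcongr; exact le_abs_self s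
        _ ≤ |s| / 2 * |s| := by gcongr
    have h3 : |s| * |s| = s ^ 2 := by rw [← sq, sq_abs]
    nlinarith
  have hs2 : 0 < s ^ 2 := by positivity
  have hr0 : (r : ℝ) ≠ 0 := by
    intro h
    rw [h, zero_mul] at hrs
    linarith
  have hr0' : r ≠ 0 := by exact_mod_cast hr0
  have hrabs : |(r : ℝ)| ≤ 2 * |s| := by
    have h2 := abs_sub_abs_le_abs_sub (r : ℝ) s
    rw [abs_sub_comm, abs_of_pos h0] at h2
    linarith
  have hnum : ((r⁻¹ : ℚ).den : ℝ) = |(r : ℝ)| * r.den := by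
    rw [Rat.den_inv_of_ne_zero hr0', Nat.cast_natAbs]
    have h2 : (r.num : ℝ) = r * r.den := by
      have := Rat.mul_den_eq_num r
      exact_mod_cast this.symm
    push_cast
    rw [h2, abs_mul, abs_of_pos (by linarith : (0 : ℝ) < r.den)]
  have hdiff : ((r⁻¹ : ℚ) : ℝ) - s⁻¹ = (s - r) / (r * s) := by
    push_cast
    field_simp
  have hrs0 : 0 < r * s := by linarith
  show 0 < ((r⁻¹ : ℚ) : ℝ) - s⁻¹ ∧ ((r⁻¹ : ℚ) : ℝ) - s⁻¹ < 1 / ((r⁻¹ : ℚ).den : ℝ) ^ v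
  rw [hdiff, hnum]
  refine ⟨by positivity, ?_⟩
  have hDr : A < (r.den : ℝ) ^ (w - v) := hD r.den (by omega)
  have hrp : 0 < |(r : ℝ)| := abs_pos.2 hr0
  have hqw : 0 < (r.den : ℝ) ^ w := by positivity
  have hqv : 0 < (r.den : ℝ) ^ v := by positivity
  calc (s - r) / (r * s) ≤ (s - r) / (s ^ 2 / 2) := by gcongr
    _ < 1 / (r.den : ℝ) ^ w / (s ^ 2 / 2) := by gcongr
    _ ≤ 1 / ((2 * |s|) ^ v * (r.den : ℝ) ^ v) := by
        rw [Real.rpow_sub (by linarith), lt_div_iff₀ hqv] at hDr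
        rw [div_div, div_le_div_iff₀ (by positivity) (by positivity), one_mul, one_mul]
        have h3 : (2 * |s|) ^ v * (r.den : ℝ) ^ v = s ^ 2 / 2 * (A * (r.den : ℝ) ^ v) := by
          rw [hA]; field_simp
        rw [h3, mul_comm ((r.den : ℝ) ^ w)]
        gcongr
    _ = 1 / (2 * |s| * r.den) ^ v := by
        rw [Real.mul_rpow (by positivity : 0 ≤ 2 * |s|) (by linarith)]
    _ ≤ 1 / (|(r : ℝ)| * r.den) ^ v := by gcongr

theorem evenExp_le_oddExp_inv {s : ℝ} (hs : Irrational s) : evenExp s ≤ oddExp s⁻¹ := by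
  have h := oddExp_le_evenExp_inv hs.neg
  rw [← evenExp_eq_oddExp_neg, evenExp_eq_oddExp_neg (-s)⁻¹, inv_neg, neg_neg] at h
  exact h

theorem oddExp_inv {s : ℝ} (hs : Irrational s) : oddExp s⁻¹ = evenExp s := by
  refine le_antisymm ?_ (evenExp_le_oddExp_inv hs)
  have := oddExp_le_evenExp_inv hs.inv
  rwa [inv_inv] at this

theorem evenExp_inv {s : ℝ} (hs : Irrational s) : evenExp s⁻¹ = oddExp s := by
  have := oddExp_inv hs.inv
  rw [inv_inv] at this
  exact this.symm

theorem oddExp_le_dioExp (s : ℝ) : oddExp s ≤ dioExp s := by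
  refine sSup_le ?_
  rintro _ ⟨w, rfl, hw⟩
  refine le_sSup ⟨w, rfl, hw.mono ?_⟩
  rintro r ⟨h0, h1⟩
  show |s - (r : ℝ)| < _
  rwa [abs_of_pos h0]

theorem evenExp_le_dioExp (s : ℝ) : evenExp s ≤ dioExp s := by
  refine sSup_le ?_
  rintro _ ⟨w, rfl, hw⟩
  refine le_sSup ⟨w, rfl, hw.mono ?_⟩
  rintro r ⟨h0, h1⟩
  show |s - (r : ℝ)| < _
  rwa [abs_sub_comm, abs_of_pos h0]

theorem dioExp_le_two {s : ℝ} (hs : Irrational s) (h : ∀ p > (2 : ℝ), ¬LiouvilleWith p s) :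
    dioExp s ≤ 2 := by
  refine sSup_le ?_
  rintro _ ⟨w, rfl, hw⟩
  by_contra hlt
  have hw2 : 2 < w := by
    rw [not_le] at hlt
    exact EReal.coe_lt_coe_iff.1 hlt
  refine h w hw2 ⟨1, Filter.frequently_atTop.2 fun D => ?_⟩
  obtain ⟨r, hr, hD⟩ := exists_den_gt hw (s := s) (B := 1) (fun r hr => by
    refine (le_of_lt hr).trans ?_
    have hd : (1 : ℝ) ≤ r.den := by exact_mod_cast r.den_pos
    exact div_le_one_of_le₀ (Real.one_le_rpow hd (by linarith)) (by positivity)) D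
  have hcast : (r : ℝ) = (r.num : ℝ) / (r.den : ℕ) := Rat.cast_def r
  refine ⟨r.den, hD.le, r.num, ?_, ?_⟩
  · rw [← hcast]
    exact fun h => hs ⟨r, h.symm⟩
  · rw [← hcast]
    exact hr

theorem exponents_eq_two {s : ℝ} (hs : Irrational s) (h : ∀ p > (2 : ℝ), ¬LiouvilleWith p s) :
    dioExp s = 2 ∧ evenExp s = 2 ∧ oddExp s = 2 := by
  have h1 := dioExp_le_two hs h
  have h2 := two_le_oddExp hs
  have h3 := two_le_evenExp hs
  have h4 := oddExp_le_dioExp s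
  have h5 := evenExp_le_dioExp s
  exact ⟨le_antisymm h1 (h2.trans h4), le_antisymm (h5.trans h1) h3,
    le_antisymm (h4.trans h1) h2⟩

/-- Fubini: on each line `a ≠ 0` the map `b ↦ b / a` pulls null sets back to null sets. A measurable
null superset makes the product criterion applicable. -/
theorem ae_not_liouvilleWith_div :
    ∀ᵐ z : ℝ × ℝ, ∀ p > (2 : ℝ), z.1 ≠ 0 → ¬LiouvilleWith p (z.2 / z.1) := by
  obtain ⟨t, hsub, ht, ht0⟩ := exists_measurable_superset_of_null
    (ae_iff.1 ae_not_liouvilleWith)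
  have hmeas : MeasurableSet {z : ℝ × ℝ | z.1 ≠ 0 ∧ z.2 / z.1 ∈ t} :=
    ((measurable_fst (measurableSet_singleton 0)).compl).inter
      ((measurable_snd.div measurable_fst) ht)
  have hnull : volume {z : ℝ × ℝ | z.1 ≠ 0 ∧ z.2 / z.1 ∈ t} = 0 := by
    rw [Measure.volume_eq_prod, Measure.measure_prod_null hmeas]
    refine Filter.Eventually.of_forall fun a => ?_
    show volume (Prod.mk a ⁻¹' {z : ℝ × ℝ | z.1 ≠ 0 ∧ z.2 / z.1 ∈ t}) = 0
    rcases eq_or_ne a 0 with rfl | ha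
    · simp
    · have : Prod.mk a ⁻¹' {z : ℝ × ℝ | z.1 ≠ 0 ∧ z.2 / z.1 ∈ t} = (fun b => b * a⁻¹) ⁻¹' t := by
        ext b
        simp [ha, div_eq_mul_inv]
      rw [this, Real.volume_preimage_mul_right (inv_ne_zero ha), ht0, mul_zero]
  rw [ae_iff]
  refine measure_mono_null ?_ hnull
  intro z hz
  simp only [Set.mem_ofPred_eq, not_forall, not_not] at hz
  obtain ⟨p, hp, hz1, hz2⟩ := hz
  exact ⟨hz1, hsub (by simp only [Set.mem_ofPred_eq, not_forall, not_not]; exact ⟨p, hp, hz2⟩)⟩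

/-! ### From Diophantine exponents to growth exponents -/

theorem exists_pos_le_sub {s v : ℝ} (hv : 0 ≤ v) (h : (oddSet s v).Finite) :
    ∃ c : ℝ, 0 < c ∧ ∀ r : ℚ, 0 < s - (r : ℝ) → c / (r.den : ℝ) ^ v ≤ s - r := by
  obtain ⟨ε, hε, hmin⟩ : ∃ ε : ℝ, 0 < ε ∧ ∀ r ∈ oddSet s v, ε ≤ s - (r : ℝ) := by
    rcases (oddSet s v).eq_empty_or_nonempty with h' | h'
    · exact ⟨1, one_pos, by simp [h']⟩
    · obtain ⟨r, hr, hmin⟩ := Set.exists_min_image _ (fun r : ℚ => s - (r : ℝ)) h h'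
      exact ⟨_, hr.1, hmin⟩
  refine ⟨min ε 1, lt_min hε one_pos, fun r hr => ?_⟩
  have hd : (1 : ℝ) ≤ (r.den : ℝ) ^ v :=
    Real.one_le_rpow (by exact_mod_cast r.den_pos) hv
  by_cases hmem : r ∈ oddSet s v
  · refine (div_le_self (le_min hε.le zero_le_one) hd).trans ?_
    exact (min_le_left _ _).trans (hmin r hmem)
  · have h1 : 1 / (r.den : ℝ) ^ v ≤ s - r := by
      by_contra hlt
      exact hmem ⟨hr, not_le.1 hlt⟩
    refine le_trans ?_ h1
    gcongr
    exact min_le_right _ _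

theorem lt_of_ratio_lt {c θ : ℝ} {e : EReal} (he : 2 ≤ e) (hθ : θ < 1) (h : ratio c e < θ) :
    e < ((c / (1 - θ) : ℝ) : EReal) := by
  unfold ratio at h
  split_ifs at h with htop
  · linarith
  · lift e to ℝ using ⟨htop, ne_of_gt (lt_of_lt_of_le (EReal.bot_lt_coe 2) he)⟩
    rw [EReal.toReal_coe] at h
    have he' : (2 : ℝ) ≤ e := EReal.coe_le_coe_iff.1 he
    rw [EReal.coe_lt_coe_iff, lt_div_iff₀ (by linarith)]
    rw [div_lt_iff₀ (by linarith)] at h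
    linarith

theorem lt_of_lt_ratio {c θ : ℝ} {e : EReal} (hc : 0 < c) (he : 2 ≤ e) (h : θ < ratio c e) :
    θ < 1 ∧ ((c / (1 - θ) : ℝ) : EReal) < e := by
  unfold ratio at h
  split_ifs at h with htop
  · rw [htop]
    exact ⟨h, EReal.coe_lt_top _⟩
  · lift e to ℝ using ⟨htop, ne_of_gt (lt_of_lt_of_le (EReal.bot_lt_coe 2) he)⟩
    rw [EReal.toReal_coe] at h
    have he' : (2 : ℝ) ≤ e := EReal.coe_le_coe_iff.1 he
    rw [lt_div_iff₀ (by linarith)] at h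
    have h1 : θ < 1 := by
      by_contra hlt
      nlinarith
    rw [EReal.coe_lt_coe_iff, div_lt_iff₀ (by linarith)]
    exact ⟨h1, by linarith⟩

theorem half_le_ratio {e : EReal} (he : 2 ≤ e) : 1 / 2 ≤ ratio 1 e := by
  unfold ratio
  split_ifs with htop
  · norm_num
  · lift e to ℝ using ⟨htop, ne_of_gt (lt_of_lt_of_le (EReal.bot_lt_coe 2) he)⟩
    have he' : (2 : ℝ) ≤ e := EReal.coe_le_coe_iff.1 he
    rw [EReal.toReal_coe, le_div_iff₀ (by linarith)]
    linarith

theorem ratio_two {c : ℝ} : ratio c 2 = (2 - c) / 2 := by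
  have h : (2 : EReal) = ((2 : ℝ) : EReal) := rfl
  rw [ratio, h, if_neg (EReal.coe_ne_top 2), EReal.toReal_coe]

namespace Orbit

variable (o : Orbit)

theorem form_rat (r : ℚ) :
    o.form ((r.den : ℤ), r.num) = o.α 0 * (r.den * (o.α 1 / o.α 0 - r)) := by
  have hnum : (r.num : ℝ) = r * r.den := by
    have := Rat.mul_den_eq_num r
    exact_mod_cast this.symm
  have := (o.pos 0).ne'
  simp only [form, hnum, Int.cast_natCast]
  field_simp

theorem form_ne_zero (hs : Irrational (o.α 1 / o.α 0)) {w : ℤ × ℤ} (hw : 1 ≤ w.1) :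
    o.form w ≠ 0 := by
  intro h
  refine hs ⟨(w.2 : ℚ) / w.1, ?_⟩
  have h1 : (w.1 : ℝ) ≠ 0 := by exact_mod_cast (by omega : w.1 ≠ 0)
  have h2 := (o.pos 0).ne'
  simp only [form] at h
  push_cast
  rw [div_eq_div_iff h1 h2]
  linarith

theorem mul_rpow_le_form {c v : ℝ} {r : ℚ} {d : ℝ}
    (h : c / (r.den : ℝ) ^ v ≤ d) :
    o.α 0 * c * (r.den : ℝ) ^ (1 - v) ≤ o.α 0 * (r.den * d) := by
  have hq : (0 : ℝ) < r.den := by exact_mod_cast r.den_pos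
  have ha := o.pos 0
  rw [Real.rpow_sub hq, Real.rpow_one, mul_assoc]
  have : c * (r.den / (r.den : ℝ) ^ v) = r.den * (c / (r.den : ℝ) ^ v) := by ring
  rw [this]
  gcongr

theorem form_le_mul_rpow {v : ℝ} {r : ℚ} {d : ℝ} (h : d ≤ 1 / (r.den : ℝ) ^ v) :
    o.α 0 * (r.den * d) ≤ 1 * (r.den : ℝ) ^ (1 - v) := by
  have hq : (0 : ℝ) < r.den := by exact_mod_cast r.den_pos
  have ha1 := o.le_one 0
  have hX : 0 ≤ (r.den : ℝ) * (1 / (r.den : ℝ) ^ v) := by positivity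
  rw [Real.rpow_sub hq, Real.rpow_one, div_eq_mul_one_div (r.den : ℝ)]
  exact (mul_le_mul_of_nonneg_left (mul_le_mul_of_nonneg_left h hq.le) (o.pos 0).le).trans
    (mul_le_mul_of_nonneg_right ha1 hX)

/-- The case `θ = 1` is trivial and serves infinite exponents. Otherwise `v = 1 / (1 - θ)` solves `θ
= (v - 1) / v` and exceeds the odd exponent, so only finitely many approximations are better than
`v`. -/
theorem exists_lowerBound (hs : Irrational (o.α 1 / o.α 0)) {θ : ℝ} (hθ0 : 0 ≤ θ)
    (h : θ = 1 ∨ θ < 1 ∧ ratio 1 (oddExp (o.α 1 / o.α 0)) < θ) :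
    ∃ C : ℝ, o.LowerBound C θ := by
  rcases h with rfl | ⟨hθ1, h⟩
  · refine ⟨1, fun u w _ hu hpos hle => ?_⟩
    have : (1 : ℝ) ≤ u.1 := by exact_mod_cast hu
    rw [Real.rpow_one, one_mul]
    gcongr
  · have hlt := lt_of_ratio_lt (two_le_oddExp hs) hθ1 h
    set v := 1 / (1 - θ) with hv
    have hv0 : 0 < v := by rw [hv]; exact one_div_pos.2 (by linarith)
    have hθv : θ = (v - 1) / v := by
      have : 1 - θ ≠ 0 := by linarith
      rw [hv]; field_simp; ring
    obtain ⟨c, hc, hmin⟩ := exists_pos_le_sub hv0.le (oddSet_finite_of_lt hlt)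
    have ha := o.pos 0
    refine ⟨1 / (o.α 0 * c) ^ (1 / v), fun u w hdet hu hpos hle => ?_⟩
    obtain ⟨r, rfl⟩ := exists_rat_of_det hdet hu
    have hq : (0 : ℝ) < r.den := by exact_mod_cast r.den_pos
    have hsr : 0 < o.α 1 / o.α 0 - r := by
      rw [form_rat] at hpos
      exact pos_of_mul_pos_right (pos_of_mul_pos_right hpos ha.le) hq.le
    have h1 := o.mul_rpow_le_form (hmin r hsr)
    rw [← form_rat] at h1
    have h2 := le_rpow_div hq hpos (by positivity) hv0 h1
    rw [← hθv] at h2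
    have h3 : 0 < (o.α 0 * c) ^ (1 / v) := by positivity
    calc 1 / o.form ((r.den : ℤ), r.num) = 1 / (o.α 0 * c) ^ (1 / v) *
          ((o.α 0 * c) ^ (1 / v) / o.form ((r.den : ℤ), r.num)) := by field_simp
      _ ≤ _ := by
        gcongr
        exact_mod_cast h2

theorem exists_upperBound (hs : Irrational (o.α 1 / o.α 0)) {θ : ℝ} (hθ0 : 0 ≤ θ)
    (h : θ = 1 ∨ θ < 1 ∧ ratio 2 (evenExp (o.α 1 / o.α 0)) < θ) :
    ∃ C : ℝ, o.UpperBound C θ := by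
  rcases h with rfl | ⟨hθ1, h⟩
  · refine ⟨1, fun u w _ hu hpos hle => ?_⟩
    have hq : (1 : ℝ) ≤ w.1 := by exact_mod_cast hu
    rw [Real.rpow_one, one_mul, div_le_div_iff₀ (by nlinarith) (by linarith), one_mul]
    have h0 : 0 < -o.form w := by linarith
    have h1 := le_mul_of_one_le_left h0.le hq
    exact h1.trans (le_mul_of_one_le_left (h0.le.trans h1) hq)
  · have hlt := lt_of_ratio_lt (two_le_evenExp hs) hθ1 h
    rw [evenExp_eq_oddExp_neg] at hlt
    set v := 2 / (1 - θ) with hv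
    have hv0 : 0 < v := by rw [hv]; exact div_pos two_pos (by linarith)
    have hθv : θ = (v - 2) / v := by
      have : 1 - θ ≠ 0 := by linarith
      rw [hv]; field_simp; ring
    obtain ⟨c, hc, hmin⟩ := exists_pos_le_sub hv0.le (oddSet_finite_of_lt hlt)
    have ha := o.pos 0
    refine ⟨1 / (o.α 0 * c) ^ (2 / v), fun u w hdet hu hneg hle => ?_⟩
    obtain ⟨r, rfl⟩ := exists_rat_of_det' hdet hu
    have hq : (0 : ℝ) < r.den := by exact_mod_cast r.den_pos
    have hform : -o.form ((r.den : ℤ), r.num) = o.α 0 * (r.den * (r - o.α 1 / o.α 0)) := by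
      rw [form_rat]; ring
    have hpos : 0 < -o.form ((r.den : ℤ), r.num) := by linarith
    have hsr : 0 < r - o.α 1 / o.α 0 := by
      rw [hform] at hpos
      exact pos_of_mul_pos_right (pos_of_mul_pos_right hpos ha.le) hq.le
    have h0 := hmin (-r) (by push_cast; linarith)
    rw [Rat.den_neg_eq_den] at h0
    have h1 := o.mul_rpow_le_form h0
    have h4 : -(o.α 1 / o.α 0) - ((-r : ℚ) : ℝ) = r - o.α 1 / o.α 0 := by push_cast; ring
    rw [h4, ← hform] at h1
    have h2 := le_rpow_div' hq hpos (by positivity) hv0 h1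
    rw [← hθv] at h2
    have h3 : 0 < (o.α 0 * c) ^ (2 / v) := by positivity
    have h5 : (((r.den : ℤ) : ℤ) : ℝ) = (r.den : ℝ) := Int.cast_natCast _
    show 1 / (((r.den : ℤ) : ℝ) * -o.form ((r.den : ℤ), r.num)) ≤
      1 / (o.α 0 * c) ^ (2 / v) * (((r.den : ℤ) : ℝ) / -o.form ((r.den : ℤ), r.num)) ^ θ
    rw [h5]
    calc 1 / (r.den * -o.form ((r.den : ℤ), r.num)) = 1 / (o.α 0 * c) ^ (2 / v) *
          ((o.α 0 * c) ^ (2 / v) / (r.den * -o.form ((r.den : ℤ), r.num))) := by field_simp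
      _ ≤ _ := by gcongr

theorem exists_sum_le_rpow (hs : Irrational (o.α 1 / o.α 0)) {θ : ℝ}
    (h1 : ratio 1 (oddExp (o.α 1 / o.α 0)) < θ) (h2 : ratio 2 (evenExp (o.α 1 / o.α 0)) < θ) :
    ∃ C : ℝ, ∀ n : ℕ, 1 ≤ n → |o.sum n| ≤ C * (n : ℝ) ^ θ := by
  have hhalf := half_le_ratio (two_le_oddExp hs)
  -- The gap between `η` and `θ` absorbs the logarithm from `exists_abs_sum_le`.
  obtain ⟨η, hη0, hηθ, hη⟩ : ∃ η : ℝ, 0 ≤ η ∧ η < θ ∧ (η = 1 ∨ η < 1 ∧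
      ratio 1 (oddExp (o.α 1 / o.α 0)) < η ∧ ratio 2 (evenExp (o.α 1 / o.α 0)) < η) := by
    obtain ⟨η, hη1, hη2⟩ := exists_between (max_lt h1 h2)
    rw [max_lt_iff] at hη1
    rcases lt_or_ge η 1 with hlt | hge
    · exact ⟨η, by linarith, hη2, Or.inr ⟨hlt, hη1⟩⟩
    · exact ⟨1, zero_le_one, by linarith, Or.inl rfl⟩
  have hη1 : η ≤ 1 := by
    rcases hη with h | h
    · exact h.le
    · exact h.1.le
  obtain ⟨C₁, hC₁⟩ := o.exists_lowerBound hs hη0 (hη.imp_right fun h => ⟨h.1, h.2.1⟩)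
  obtain ⟨C₂, hC₂⟩ := o.exists_upperBound hs hη0 (hη.imp_right fun h => ⟨h.1, h.2.2⟩)
  set C := max 1 (max C₁ C₂) with hC
  have hlow : o.LowerBound C η := fun u w hdet hu hpos hle => by
    refine (hC₁ u w hdet hu hpos hle).trans ?_
    have : (0 : ℝ) ≤ u.1 := by exact_mod_cast (by omega : 0 ≤ u.1)
    gcongr
    exact (le_max_left _ _).trans (le_max_right _ _)
  have hupp : o.UpperBound C η := fun u w hdet hw hneg hle => by
    refine (hC₂ u w hdet hw hneg hle).trans ?_
    have : (0 : ℝ) ≤ w.1 := by exact_mod_cast (by omega : 0 ≤ w.1)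
    have : 0 ≤ -o.form w := by linarith
    gcongr
    exact (le_max_right _ _).trans (le_max_right _ _)
  obtain ⟨K, hK⟩ := o.exists_abs_sum_le hη0 hη1 (le_max_left _ _) hlow hupp
    fun w hw => o.form_ne_zero hs hw
  have hε : 0 < θ - η := by linarith
  refine ⟨|K| * (1 + 1 / (θ - η)), fun n hn => ?_⟩
  have hn1 : (1 : ℝ) ≤ n := by exact_mod_cast hn
  have hlog : Real.log n ≤ (n : ℝ) ^ (θ - η) / (θ - η) :=
    Real.log_le_rpow_div (by linarith) hε
  have h3 : (1 : ℝ) ≤ (n : ℝ) ^ (θ - η) := Real.one_le_rpow hn1 hε.le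
  have hlog0 := Real.log_nonneg hn1
  have h4 : (n : ℝ) ^ θ = (n : ℝ) ^ η * (n : ℝ) ^ (θ - η) := by
    rw [← Real.rpow_add (by linarith)]; ring_nf
  calc |o.sum n| ≤ K * (n : ℝ) ^ η * (1 + Real.log n) := hK n hn
    _ ≤ |K| * (n : ℝ) ^ η * ((n : ℝ) ^ (θ - η) + (n : ℝ) ^ (θ - η) / (θ - η)) := by
        gcongr
        exact le_abs_self K
    _ = |K| * (1 + 1 / (θ - η)) * (n : ℝ) ^ θ := by rw [h4]; ring

theorem exists_rpow_lt {y ε : ℝ} (hy : y < 0) (hε : 0 < ε) :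
    ∃ D : ℕ, ∀ q : ℕ, D ≤ q → (q : ℝ) ^ y < ε := by
  have h := (tendsto_rpow_neg_atTop (neg_pos.2 hy)).comp tendsto_natCast_atTop_atTop
  rw [neg_neg] at h
  exact (h.eventually_lt_const hε).exists_forall_of_atTop

theorem growsAtLeast_of_lt_ratio_odd (hs : Irrational (o.α 1 / o.α 0)) {θ : ℝ} (hθ : 0 < θ)
    (h : θ < ratio 1 (oddExp (o.α 1 / o.α 0))) : GrowsAtLeast o.sum θ := by
  obtain ⟨hθ1, hlt⟩ := lt_of_lt_ratio one_pos (two_le_oddExp hs) h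
  set v := 1 / (1 - θ) with hv
  have hv1 : 1 < v := by rw [hv, lt_div_iff₀ (by linarith)]; linarith
  have hθv : θ = (v - 1) / v := by
    have : 1 - θ ≠ 0 := by linarith
    rw [hv]; field_simp; ring
  have hinf := oddSet_infinite_of_lt hlt
  rw [hθv]
  refine o.growsAtLeast_of_form_pos one_pos hv1 fun ε hε => ?_
  obtain ⟨D, hD⟩ := exists_rpow_lt (by linarith : 1 - v < 0) hε
  obtain ⟨r, hr, hrD⟩ := exists_mem_oddSet_den_gt (by linarith) hinf D
  obtain ⟨w, hw⟩ := exists_det_eq_one r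
  have hq : (0 : ℝ) < r.den := by exact_mod_cast r.den_pos
  have h1 := o.form_le_mul_rpow hr.2.le
  have h2 := hD r.den hrD.le
  refine ⟨((r.den : ℤ), r.num), w, hw, Int.natCast_pos.2 r.den_pos, ?_, ?_, ?_⟩
  · rw [form_rat]
    exact mul_pos (o.pos 0) (mul_pos hq hr.1)
  · rw [form_rat]
    linarith
  · rw [form_rat]
    exact_mod_cast h1

theorem growsAtLeast_of_lt_ratio_even (hs : Irrational (o.α 1 / o.α 0)) {θ : ℝ} (hθ : 0 < θ)
    (h : θ < ratio 2 (evenExp (o.α 1 / o.α 0))) : GrowsAtLeast o.sum θ := by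
  obtain ⟨hθ1, hlt⟩ := lt_of_lt_ratio two_pos (two_le_evenExp hs) h
  rw [evenExp_eq_oddExp_neg] at hlt
  set v := 2 / (1 - θ) with hv
  have hv1 : 2 < v := by rw [hv, lt_div_iff₀ (by linarith)]; linarith
  have hθv : θ = (v - 2) / v := by
    have : 1 - θ ≠ 0 := by linarith
    rw [hv]; field_simp; ring
  have hinf := oddSet_infinite_of_lt hlt
  rw [hθv]
  refine o.growsAtLeast_of_form_neg one_pos hv1 fun ε hε => ?_
  obtain ⟨D, hD⟩ := exists_rpow_lt (by linarith : 2 - v < 0) hε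
  obtain ⟨r, hr, hrD⟩ := exists_mem_oddSet_den_gt (by linarith) hinf (D + 1)
  obtain ⟨z, hz⟩ := exists_det_eq_one' (-r)
  have hq : (0 : ℝ) < r.den := by exact_mod_cast r.den_pos
  have h1 := o.form_le_mul_rpow hr.2.le
  have h2 := hD r.den (by omega)
  have hform : -o.form (((-r).den : ℤ), (-r).num) =
      o.α 0 * (r.den * (-(o.α 1 / o.α 0) - r)) := by
    rw [form_rat, Rat.den_neg_eq_den]; push_cast; ring
  have hpos : 0 < -o.form (((-r).den : ℤ), (-r).num) := by
    rw [hform]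
    exact mul_pos (o.pos 0) (mul_pos hq hr.1)
  refine ⟨z, (((-r).den : ℤ), (-r).num), hz, ?_, by linarith, ?_, ?_⟩
  · rw [Rat.den_neg_eq_den]
    show (2 : ℤ) ≤ (r.den : ℤ)
    exact_mod_cast (by omega : 2 ≤ r.den)
  · rw [hform, Rat.den_neg_eq_den]
    have h3 : (r.den : ℝ) * (r.den : ℝ) ^ (1 - v) = (r.den : ℝ) ^ (2 - v) := by
      rw [← Real.rpow_one_add' hq.le (by linarith)]; ring_nf
    calc _ ≤ (r.den : ℝ) * (1 * (r.den : ℝ) ^ (1 - v)) := by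
          simp only [Int.cast_natCast]
          gcongr
      _ < ε := by rw [one_mul, h3]; exact h2
  · rw [hform, Rat.den_neg_eq_den]
    exact_mod_cast h1

end Orbit
-- Logarithmic speed
theorem GrowsAtLeast.exists_ge {f : ℕ → ℝ} {θ : ℝ} (h : GrowsAtLeast f θ) :
    ∃ c : ℝ, 0 < c ∧ ∀ (K : ℝ) (m : ℕ), ∃ n : ℕ, m < n ∧ K ≤ |f n| ∧ c * (n : ℝ) ^ θ ≤ |f n| := by
  obtain ⟨c, hc, h⟩ := h
  refine ⟨c, hc, fun K m => ?_⟩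
  have hS : 0 ≤ ∑ i ∈ Finset.range (m + 1), |f i| := Finset.sum_nonneg fun i _ => abs_nonneg _
  obtain ⟨n, hn, hK, hle⟩ := h (|K| + ∑ i ∈ Finset.range (m + 1), |f i| + 1)
  refine ⟨n, ?_, by linarith [le_abs_self K], hle⟩
  by_contra hlt
  have := Finset.single_le_sum (f := fun i => |f i|) (fun i _ => abs_nonneg _)
    (Finset.mem_range.2 (by omega : n < m + 1))
  linarith [abs_nonneg K]

theorem GrowsAtLeast.shift {f : ℕ → ℝ} {θ : ℝ} (hθ : 0 ≤ θ) (h : GrowsAtLeast f θ) (c : ℝ) :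
    GrowsAtLeast (fun n => f (n + 2) - c) θ := by
  obtain ⟨d, hd, h⟩ := h.exists_ge
  refine ⟨d / 2, by positivity, fun K => ?_⟩
  obtain ⟨n, hn, hK, hle⟩ := h (|K| + 2 * |c|) 2
  obtain ⟨m, rfl⟩ := Nat.exists_eq_add_of_lt hn
  have h1 := abs_sub_abs_le_abs_sub (f (2 + m + 1)) c
  have h2 : 2 + m + 1 = m + 1 + 2 := by ring
  rw [h2] at h1 hK hle
  have h3 := le_abs_self K
  have h4 := abs_nonneg K
  have h5 := abs_nonneg c
  refine ⟨m + 1, by omega, by linarith, ?_⟩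
  have h6 : ((m + 1 : ℕ) : ℝ) ^ θ ≤ ((m + 1 + 2 : ℕ) : ℝ) ^ θ :=
    Real.rpow_le_rpow (Nat.cast_nonneg _) (by exact_mod_cast (by omega)) hθ
  have h7 := mul_le_mul_of_nonneg_left h6 hd.le
  linarith

theorem exists_shift_le_rpow {f : ℕ → ℝ} {θ : ℝ} (hθ : 0 ≤ θ)
    (h : ∃ C : ℝ, ∀ n : ℕ, 1 ≤ n → |f n| ≤ C * (n : ℝ) ^ θ) (c : ℝ) :
    ∃ C : ℝ, ∀ n : ℕ, 1 ≤ n → |f (n + 2) - c| ≤ C * (n : ℝ) ^ θ := by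
  obtain ⟨C, hC⟩ := h
  refine ⟨|C| * 3 ^ θ + |c|, fun n hn => ?_⟩
  have hn1 : (1 : ℝ) ≤ n := by exact_mod_cast hn
  have h1 : (((n + 2 : ℕ) : ℝ)) ^ θ ≤ 3 ^ θ * (n : ℝ) ^ θ := by
    rw [← Real.mul_rpow (by norm_num) (by linarith)]
    refine Real.rpow_le_rpow (by positivity) ?_ hθ
    push_cast
    linarith
  have h2 : (1 : ℝ) ≤ (n : ℝ) ^ θ := Real.one_le_rpow hn1 hθ
  calc |f (n + 2) - c| ≤ |f (n + 2)| + |c| := abs_sub _ _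
    _ ≤ C * ((n + 2 : ℕ) : ℝ) ^ θ + |c| := by linarith [hC (n + 2) (by omega)]
    _ ≤ |C| * (3 ^ θ * (n : ℝ) ^ θ) + |c| * (n : ℝ) ^ θ := by
        refine add_le_add ?_ (le_mul_of_one_le_right (abs_nonneg c) h2)
        exact mul_le_mul (le_abs_self C) h1 (by positivity) (abs_nonneg C)
    _ = (|C| * 3 ^ θ + |c|) * (n : ℝ) ^ θ := by ring

theorem logSpeed_eq {f : ℕ → ℝ} {θ : ℝ} (hθ : 0 < θ)
    (hU : ∀ η : ℝ, θ < η → ∃ C : ℝ, ∀ n : ℕ, 1 ≤ n → |f n| ≤ C * (n : ℝ) ^ η)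
    (hL : ∀ η : ℝ, 0 < η → η < θ → GrowsAtLeast f η) : logSpeed f = (θ : EReal) := by
  have hlog : Tendsto (fun n : ℕ => Real.log n) atTop atTop :=
    Real.tendsto_log_atTop.comp tendsto_natCast_atTop_atTop
  refine le_antisymm ?_ ?_
  · rw [← EReal.le_of_forall_lt_iff_le]
    intro z hz
    rw [EReal.coe_lt_coe_iff] at hz
    obtain ⟨η, hη1, hη2⟩ := exists_between hz
    obtain ⟨C, hC⟩ := hU η hη1
    refine limsup_le_of_le (by isBoundedDefault) ?_
    filter_upwards [eventually_ge_atTop 1, hlog.eventually_gt_atTop 0,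
      hlog.eventually_ge_atTop (Real.log (max C 1) / (z - η))] with n hn hn0 hnC
    rw [EReal.coe_le_coe_iff, div_le_iff₀ hn0]
    have hn1 : (0 : ℝ) < n := by exact_mod_cast hn
    rcases eq_or_ne (f n) 0 with h0 | h0
    · rw [h0, abs_zero, Real.log_zero]
      exact mul_nonneg (by linarith) hn0.le
    · have h1 : |f n| ≤ max C 1 * (n : ℝ) ^ η :=
        (hC n hn).trans (by gcongr; exact le_max_left _ _)
      have h2 := Real.log_le_log (abs_pos.2 h0) h1
      rw [Real.log_mul (by positivity) (by positivity), Real.log_rpow hn1] at h2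
      rw [div_le_iff₀ (by linarith)] at hnC
      linarith
  · rw [← EReal.ge_of_forall_gt_iff_ge]
    intro z hz
    rw [EReal.coe_lt_coe_iff] at hz
    obtain ⟨η, hη1, hη2⟩ := exists_between (max_lt hz hθ)
    rw [max_lt_iff] at hη1
    obtain ⟨c, hc, hgrow⟩ := (hL η hη1.2 hη2).exists_ge
    refine le_limsup_of_frequently_le ?_ (by isBoundedDefault)
    rw [Filter.frequently_atTop]
    intro m
    obtain ⟨M, hM⟩ := ((hlog.eventually_gt_atTop 0).and (hlog.eventually_ge_atTop
      (-Real.log c / (η - z)))).exists_forall_of_atTop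
    obtain ⟨n, hn, -, hle⟩ := hgrow 0 (m + M)
    obtain ⟨hn0, hnc⟩ := hM n (by omega)
    refine ⟨n, by omega, ?_⟩
    rw [EReal.coe_le_coe_iff, le_div_iff₀ hn0]
    have hn1 : (0 : ℝ) < n := by exact_mod_cast (by omega : 0 < n)
    have h2 := Real.log_le_log (by positivity) hle
    rw [Real.log_mul (by positivity) (by positivity), Real.log_rpow hn1] at h2
    rw [div_le_iff₀ (by linarith)] at hnc
    linarith

/-! ### Points of the Farey triangle and time reversal -/

/-- The forward orbit of a point of the Farey triangle. -/
noncomputable def orbit (x : Farey) : Orbit where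
  α n := ((T ^ n) x).1.1
  -- The shift makes `κ 0` the index at `T⁻¹ x`, which the symmetrized sum needs.
  κ n := k ((T ^ ((n : ℤ) - 1)) x)
  pos n := ((T ^ n) x).2.1.1
  le_one n := ((T ^ n) x).2.1.2
  one_lt n := by
    rw [pow_succ']
    exact ((T ^ n) x).2.2.2
  add_eq n := by
    have h : ((n + 1 : ℕ) : ℤ) - 1 = (n : ℤ) := by push_cast; ring
    rw [h, zpow_natCast, pow_succ', pow_succ']
    show _ + (-((T ^ n) x).1.1 + (index ((T ^ n) x).1 : ℝ) * ((T ^ n) x).1.2) =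
      (index ((T ^ n) x).1 : ℝ) * ((T ^ n) x).1.2
    ring

theorem orbit_sum (x : Farey) : (orbit x).sum = fHat x := by
  funext n
  refine Finset.sum_congr rfl fun i hi => ?_
  have hi1 : 1 ≤ i := (Finset.mem_Icc.1 hi).1
  have h : ((i - 1 : ℕ) : ℤ) - 1 = -1 + ((i : ℤ) - 1) := by omega
  show ((k _ : ℝ) + (k ((T ^ (((i - 1 : ℕ) : ℤ) - 1)) x) : ℝ)) / 2 - 3 = _
  rw [h, zpow_add, zpow_neg_one]
  rfl

/-- The swap of the two coordinates on the Farey triangle. -/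
def swapFarey (x : Farey) : Farey := ⟨x.1.swap, swap_mem x.2⟩

/-- The swap conjugates the map to its inverse. As it also preserves `kHat`, backward sums are
forward sums at the swapped point. -/
theorem inv_T_pow (n : ℕ) (x : Farey) : (T⁻¹ ^ n) x = swapFarey ((T ^ n) (swapFarey x)) := by
  induction n with
  | zero => rfl
  | succ n ih =>
    rw [pow_succ', pow_succ', Equiv.Perm.mul_apply, ih]
    rfl

theorem k_inv_T (x : Farey) : k (T⁻¹ x) = k (swapFarey x) := by
  obtain ⟨⟨a, b⟩, ⟨ha, ha1⟩, ⟨hb, hb1⟩, hab⟩ := x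
  simp only at ha ha1 hb hb1 hab
  show index (mapFun (b, a)).swap = index (b, a)
  have e : index (mapFun (b, a)).swap = ⌊(1 + (-b + (index (b, a) : ℝ) * a)) / a⌋ := rfl
  rw [e, Int.floor_eq_iff, le_div_iff₀ ha, div_lt_iff₀ ha]
  constructor <;> linarith

theorem kHat_swap (x : Farey) : kHat (swapFarey x) = kHat x := by
  have h : swapFarey (swapFarey x) = x := rfl
  rw [kHat, kHat, k_inv_T, k_inv_T, h, add_comm]

/-- The backward sum has `n + 1` terms and starts at `T⁻¹ x`, so it is a forward sum of `n + 2`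
terms without the one at time 0. -/
theorem fHatNeg_eq (x : Farey) (n : ℕ) :
    fHatNeg x n = fHat (swapFarey x) (n + 2) - (kHat (swapFarey x) - 3) := by
  have h1 : fHat (swapFarey x) (n + 2) =
      ∑ i ∈ Finset.range (n + 2), (kHat ((T ^ i) (swapFarey x)) - 3) := by
    rw [fHat, ← Finset.Ico_add_one_right_eq_Icc, Finset.sum_Ico_eq_sum_range]
    refine Finset.sum_congr rfl fun i _ => ?_
    have : ((1 + i : ℕ) : ℤ) - 1 = (i : ℤ) := by push_cast; ring
    rw [this, zpow_natCast]
  rw [h1, Finset.sum_range_succ']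
  have h2 : fHatNeg x n = ∑ i ∈ Finset.range (n + 1), (kHat ((T ^ (i + 1)) (swapFarey x)) - 3) := by
    refine Finset.sum_congr rfl fun i _ => ?_
    have : -(i : ℤ) - 1 = -((i + 1 : ℕ) : ℤ) := by push_cast; ring
    rw [this, zpow_neg, zpow_natCast, ← inv_pow, inv_T_pow, kHat_swap]
  rw [h2, pow_zero, Equiv.Perm.one_apply]
  ring

theorem max_ratio_pos {s : ℝ} (hs : Irrational s) :
    0 < max (ratio 1 (oddExp s)) (ratio 2 (evenExp s)) :=
  lt_of_lt_of_le (by linarith [half_le_ratio (two_le_oddExp hs)]) (le_max_left _ _)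

theorem exists_fHat_le_rpow {x : Farey} (hs : Irrational (x.1.2 / x.1.1)) {η : ℝ}
    (h : max (ratio 1 (oddExp (x.1.2 / x.1.1))) (ratio 2 (evenExp (x.1.2 / x.1.1))) < η) :
    ∃ C : ℝ, ∀ n : ℕ, 1 ≤ n → |fHat x n| ≤ C * (n : ℝ) ^ η := by
  rw [← orbit_sum]
  exact (orbit x).exists_sum_le_rpow hs (max_lt_iff.1 h).1 (max_lt_iff.1 h).2

theorem growsAtLeast_fHat {x : Farey} (hs : Irrational (x.1.2 / x.1.1)) {η : ℝ} (hη : 0 < η)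
    (h : η < max (ratio 1 (oddExp (x.1.2 / x.1.1))) (ratio 2 (evenExp (x.1.2 / x.1.1)))) :
    GrowsAtLeast (fHat x) η := by
  rw [← orbit_sum]
  rcases lt_max_iff.1 h with h | h
  · exact (orbit x).growsAtLeast_of_lt_ratio_odd hs hη h
  · exact (orbit x).growsAtLeast_of_lt_ratio_even hs hη h

theorem logSpeed_fHat {x : Farey} (hs : Irrational (x.1.2 / x.1.1)) :
    logSpeed (fHat x) = ((max (ratio 1 (oddExp (x.1.2 / x.1.1)))
      (ratio 2 (evenExp (x.1.2 / x.1.1))) : ℝ) : EReal) :=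
  logSpeed_eq (max_ratio_pos hs) (fun _ h => exists_fHat_le_rpow hs h)
    fun _ h0 h => growsAtLeast_fHat hs h0 h

theorem logSpeed_fHatNeg {x : Farey} (hs : Irrational (x.1.2 / x.1.1)) :
    logSpeed (fHatNeg x) = ((max (ratio 1 (evenExp (x.1.2 / x.1.1)))
      (ratio 2 (oddExp (x.1.2 / x.1.1))) : ℝ) : EReal) := by
  have hinv : (swapFarey x).1.2 / (swapFarey x).1.1 = (x.1.2 / x.1.1)⁻¹ := (inv_div _ _).symm
  have hs' : Irrational ((swapFarey x).1.2 / (swapFarey x).1.1) := by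
    rw [hinv]
    exact hs.inv
  have hf : fHatNeg x = fun n => fHat (swapFarey x) (n + 2) - (kHat (swapFarey x) - 3) :=
    funext (fHatNeg_eq x)
  have hpos := max_ratio_pos hs'
  rw [← oddExp_inv hs, ← evenExp_inv hs, ← hinv, hf]
  exact logSpeed_eq hpos
    (fun _ h => exists_shift_le_rpow (hpos.trans h).le (exists_fHat_le_rpow hs' h) _)
    fun _ h0 h => (growsAtLeast_fHat hs' h0 h).shift h0.le _

end BCZ

theorem corollary1p6 :
    (∀ x : BCZ.Farey, Irrational (x.1.2 / x.1.1) →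
      BCZ.logSpeed (BCZ.fHat x) =
        ((max (BCZ.ratio 1 (BCZ.oddExp (x.1.2 / x.1.1)))
          (BCZ.ratio 2 (BCZ.evenExp (x.1.2 / x.1.1))) : ℝ) : EReal)) ∧
    (∀ x : BCZ.Farey, Irrational (x.1.2 / x.1.1) →
      BCZ.logSpeed (BCZ.fHatNeg x) =
        ((max (BCZ.ratio 1 (BCZ.evenExp (x.1.2 / x.1.1)))
          (BCZ.ratio 2 (BCZ.oddExp (x.1.2 / x.1.1))) : ℝ) : EReal)) ∧
    (∀ᵐ z : ℝ × ℝ, ∀ hz : z ∈ BCZ.Farey, Irrational (z.2 / z.1) →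
      BCZ.dioExp (z.2 / z.1) = 2 ∧
      BCZ.evenExp (z.2 / z.1) = 2 ∧
      BCZ.oddExp (z.2 / z.1) = 2 ∧
      BCZ.logSpeed (BCZ.fHat ⟨z, hz⟩) = ((1 / 2 : ℝ) : EReal) ∧
      BCZ.logSpeed (BCZ.fHatNeg ⟨z, hz⟩) = ((1 / 2 : ℝ) : EReal)) := by
  refine ⟨fun x hs => BCZ.logSpeed_fHat hs, fun x hs => BCZ.logSpeed_fHatNeg hs, ?_⟩
  filter_upwards [BCZ.ae_not_liouvilleWith_div] with z hz hmem hs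
  obtain ⟨h1, h2, h3⟩ := BCZ.exponents_eq_two hs fun p hp => hz p hp hmem.1.1.ne'
  have hmax : max (BCZ.ratio 1 2) (BCZ.ratio 2 2) = 1 / 2 := by
    rw [BCZ.ratio_two, BCZ.ratio_two]
    norm_num
  refine ⟨h1, h2, h3, ?_, ?_⟩
  · rw [BCZ.logSpeed_fHat (x := ⟨z, hmem⟩) hs]
    simp only [h2, h3, hmax]
  · rw [BCZ.logSpeed_fHatNeg (x := ⟨z, hmem⟩) hs]
    simp only [h2, h3, hmax]
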